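/- Let $\mathcal S_n=\{0,1\}^n$ be the set of $n$-bit strings and $\mathcal S=\bigcup_{k\ge 0}\mathcal S_k$. Fix a deletion probability $q\in(0,1)$. A trace of $x\in\mathcal S_n$ is the random string in $\mathcal S$ obtained from $x$ by deleting each bit independently with probability $q$ and concatenating the retained bits in their original order. For $T\in\mathbb N$, let $\mathbb P_x$ denote the law of a tuple $\mathfrak X=(\tilde x^{(1)},\dots,\tilde x^{(T)})$ of $T$ independent traces of $x$. The probability of reconstructing random $n$-bit strings from $T$ traces is $$\max_{G\colon \mathcal S^T\to\{0,1\}^n}\ \sum_{x\in\mathcal S_n} 2^{-n}\,\mathbb P_x\bigl[G(\mathfrak X)=x\bigr].$$ Proposition. For every $q\in(0,1)$ there is a constant $c>0$ (depending only on $q$) such that for all sufficiently large $n$, the probability of reconstructing random $n$-bit strings from $\bigl\lceil c\,\log^{9/4} n/\sqrt{\log\log n}\,\bigr\rceil$ traces is at most $\exp(-n^{0.15})$; that is, with $T=\bigl\lceil c\,(\log n)^{9/4}/\sqrt{\log\log n}\,\bigr\rceil$, every function $G\colon\mathcal S^T\to\{0,1\}^n$ satisfies $$\sum_{x\in\mathcal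 S_n}2^{-n}\,\mathbb P_x\bigl[G(\mathfrak X)=x\bigr]\le \exp(-n^{0.15}).$$ -/

import Mathlib

open Filter

noncomputable section

namespace TraceReconstruction

/-- Bit strings of length `n`. -/
abbrev BitString (n : ℕ) : Type := Fin n → Bool

/-- The contracted string that is left of `x` when exactly the bits at the positions in `K` are
retained: the bits `x k`, `k ∈ K`, in their original order, without their positions. -/
def trace {n : ℕ} (x : BitString n) (K : Finset (Fin n)) : List Bool :=
  ((List.finRange n).filter (fun k => k ∈ K)).map x

/-- The probability that, when each of `n` positions is deleted independently with probability `q`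
(and retained with probability `1 - q`), the set of retained positions is exactly `K`. -/
def retainWeight (q : ℝ) {n : ℕ} (K : Finset (Fin n)) : ℝ :=
  ∏ k : Fin n, if k ∈ K then 1 - q else q

/-- The probability, for the deletion channel with deletion probability `q` and input string `x`,
that the tuple of `T` independent traces of `x` lies in the event `A`. The sum runs over the sets
`K t` of positions retained in the `t`-th trace; these sets are independent for different `t`. -/
def traceProb (q : ℝ) {n : ℕ} (x : BitString n) (T : ℕ) (A : Set (Fin T → List Bool)) : ℝ :=
  open Classical in
  ∑ K : Fin T → Finset (Fin n),
    if (fun t => trace x (K t)) ∈ A then ∏ t : Fin T, retainWeight q (K t) else 0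

/-- The probability with which the reconstruction function `G`, applied to `T` independent traces,
returns the input string, when the input string is uniformly distributed on the `n`-bit strings:
`∑ x, P_x[G(traces) = x] * 2⁻ⁿ`. -/
def randomSuccessProb (q : ℝ) (n T : ℕ) (G : (Fin T → List Bool) → BitString n) : ℝ :=
  ∑ x : BitString n, traceProb q x T {X | G X = x} * ((2 : ℝ) ^ n)⁻¹

end TraceReconstruction

end

namespace TraceReconstruction

/-! Cut the uniform string into about `n / L` blocks of length `L` of order `log n`, and tell the
guesser which part of each trace comes from which block. The success probability is then at most a
product over the blocks (`Dominated.append`). For one block it is at most `2⁻ᴸ` times the sum over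
trace tuples of the largest of the `2ᴸ` laws. Replacing that maximum by the sum of all laws minus
the minimum of two of them gains `δ = S ^ (2 * T) / 2 ^ (L + 1)`, where `S` is the Hellinger
affinity of single traces of two distinct strings (`dominated_of_affinity`). So the success
probability is at most `(1 - δ) ^ (n / L)`, and it remains to find two strings with `S` close to 1.

The two strings are `(01)^k 1 (01)^(k+1)` and `(01)^(k+1) 1 (01)^k`: the defect `1` moves by one
block. Represent the trace of a block as invisible with probability `e = q² / 2`, and otherwise as
one of four visible letters; `e` is the same for both kinds of block. The trace is a function of the
word of visible letters, so it suffices to bound the affinity of the word laws. For a word of `ℓ`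
letters the difference of the two likelihood ratios is a linear statistic `∑ D i * (ρ (s i) - 1)` in
independent centred letters, so its second moment is proportional to `∑ D i ^ 2`. Each `D i` is `(ℓ
- 1 - 2 * i) / (k + 1)` times a product of two binomial coefficients. Relative to the total, these
hypergeometric weights have maximum of order `k ^ (-1/2)` and the factor has mean square of order `1
/ k`; hence `1 - S` is at most of order `k ^ (-3/2)` (`exists_pair_affinity`).

With `k` of order `log n`, a number of traces up to a small multiple of `(log n) ^ (5/2)` leaves `δ`
at least of order `n ^ (-1/2)`. The exponent `9/4` is smaller, so the claim holds with room to
spare. -/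

/-! ### Hypergeometric weights: second moment, maximum and squared differences. -/

theorem succ_mul_choose_cast (k i : ℕ) :
    ((k : ℝ) + 1) * (k.choose i : ℝ) = ((k : ℝ) + 1 - i) * ((k + 1).choose i : ℝ) := by
  rcases le_or_gt i (k + 1) with h | h
  · have := Nat.choose_mul_succ_eq k i
    have h2 : ((k + 1 - i : ℕ) : ℝ) = (k : ℝ) + 1 - i := by push_cast [Nat.cast_sub h]; ring
    rw [← h2]
    rw [mul_comm, mul_comm (_ : ℝ) ((k + 1).choose i : ℝ)]
    exact_mod_cast this
  · rw [Nat.choose_eq_zero_of_lt h, Nat.choose_eq_zero_of_lt (by omega)]; simp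

theorem choose_mul_choose_succ_sub (k i b : ℕ) :
    ((k : ℝ) + 1) * ((k.choose i : ℝ) * ((k + 1).choose b : ℝ)
      - ((k + 1).choose i : ℝ) * (k.choose b : ℝ))
      = ((b : ℝ) - i) * (((k + 1).choose i : ℝ) * ((k + 1).choose b : ℝ)) := by
  linear_combination ((k + 1).choose b : ℝ) * succ_mul_choose_cast k i
    - ((k + 1).choose i : ℝ) * succ_mul_choose_cast k b

theorem choose_mul_choose_sub_shift (k i b : ℕ) :
    ((k : ℝ) + 1) * ((k.choose (i + 1) : ℝ) * (k.choose b : ℝ)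
      - (k.choose i : ℝ) * (k.choose (b + 1) : ℝ))
      = ((b : ℝ) - i) * (((k + 1).choose (i + 1) : ℝ) * ((k + 1).choose (b + 1) : ℝ)) := by
  have h := choose_mul_choose_succ_sub k (i + 1) (b + 1)
  have h1 : ((k + 1).choose (i + 1) : ℝ) = k.choose i + k.choose (i + 1) := by
    exact_mod_cast Nat.choose_succ_succ' k i
  have h2 : ((k + 1).choose (b + 1) : ℝ) = k.choose b + k.choose (b + 1) := by
    exact_mod_cast Nat.choose_succ_succ' k b
  rw [h1, h2] at h ⊢
  push_cast at h
  linear_combination h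

theorem sum_antidiagonal_choose_mul (k n : ℕ) :
    ∑ p ∈ Finset.HasAntidiagonal.antidiagonal n, ((k.choose p.1 : ℝ) * (k.choose p.2 : ℝ))
      = ((2 * k).choose n : ℝ) := by
  rw [two_mul, Nat.add_choose_eq]
  push_cast
  rfl

/-- Summation by parts: one factor `p.2 - p.1` turns the weight into a discrete difference, and
Pascal's rule shifts that difference onto the other factor. This gives the exact variance of a
hypergeometric distribution. -/
theorem sum_antidiagonal_sq_mul_choose (k n : ℕ) :
    ∑ p ∈ Finset.HasAntidiagonal.antidiagonal (n + 1), ((p.2 : ℝ) - p.1) ^ 2 *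
        (((k + 1).choose p.1 : ℝ) * ((k + 1).choose p.2 : ℝ))
      = 2 * (k + 1) * ((2 * k).choose n : ℝ) := by
  have h : ∀ p : ℕ × ℕ, ((p.2 : ℝ) - p.1) ^ 2 *
        (((k + 1).choose p.1 : ℝ) * ((k + 1).choose p.2 : ℝ))
      = ((k : ℝ) + 1) * (((p.2 : ℝ) - p.1) * ((k.choose p.1 : ℝ) * ((k + 1).choose p.2 : ℝ)))
       - ((k : ℝ) + 1) * (((p.2 : ℝ) - p.1) * (((k + 1).choose p.1 : ℝ) * (k.choose p.2 : ℝ))) := by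
    intro p
    linear_combination (-((p.2 : ℝ) - p.1)) * choose_mul_choose_succ_sub k p.1 p.2
  simp_rw [h]
  rw [Finset.sum_sub_distrib, ← Finset.mul_sum, ← Finset.mul_sum]
  have hA : ∑ p ∈ Finset.HasAntidiagonal.antidiagonal (n + 1),
        ((p.2 : ℝ) - p.1) * ((k.choose p.1 : ℝ) * ((k + 1).choose p.2 : ℝ))
      = ∑ p ∈ Finset.HasAntidiagonal.antidiagonal (n + 1), ((p.2 : ℝ) - p.1) * ((k.choose p.1 : ℝ) * (k.choose p.2 : ℝ))
       + ∑ p ∈ Finset.HasAntidiagonal.antidiagonal n, ((p.2 : ℝ) + 1 - p.1) * ((k.choose p.1 : ℝ) * (k.choose p.2 : ℝ)) := by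
    rw [Finset.Nat.sum_antidiagonal_succ', Finset.Nat.sum_antidiagonal_succ', add_assoc,
      ← Finset.sum_add_distrib]
    congr 1
    · simp
    · refine Finset.sum_congr rfl fun p _ => ?_
      rw [Nat.choose_succ_succ' k p.2]
      push_cast
      ring
  have hB : ∑ p ∈ Finset.HasAntidiagonal.antidiagonal (n + 1),
        ((p.2 : ℝ) - p.1) * (((k + 1).choose p.1 : ℝ) * (k.choose p.2 : ℝ))
      = ∑ p ∈ Finset.HasAntidiagonal.antidiagonal (n + 1), ((p.2 : ℝ) - p.1) * ((k.choose p.1 : ℝ) * (k.choose p.2 : ℝ))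
       + ∑ p ∈ Finset.HasAntidiagonal.antidiagonal n, ((p.2 : ℝ) - (p.1 + 1)) * ((k.choose p.1 : ℝ) * (k.choose p.2 : ℝ)) := by
    rw [Finset.Nat.sum_antidiagonal_succ, Finset.Nat.sum_antidiagonal_succ, add_assoc,
      ← Finset.sum_add_distrib]
    congr 1
    · simp
    · refine Finset.sum_congr rfl fun p _ => ?_
      rw [Nat.choose_succ_succ' k p.1]
      push_cast
      ring
  -- The sums over the longer antidiagonal cancel; on the shorter one the coefficients differ by
  -- exactly 2.
  rw [hA, hB, ← sum_antidiagonal_choose_mul]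
  rw [← mul_sub, add_sub_add_left_eq_sub, ← Finset.sum_sub_distrib, Finset.mul_sum, Finset.mul_sum]
  refine Finset.sum_congr rfl fun p _ => ?_
  ring

theorem sum_antidiagonal_abs_mul_choose_le (k n : ℕ) :
    ∑ p ∈ Finset.HasAntidiagonal.antidiagonal (n + 1), |(p.2 : ℝ) - p.1| *
        (((k + 1).choose p.1 : ℝ) * ((k + 1).choose p.2 : ℝ))
      ≤ √(2 * (k + 1) * ((2 * k).choose n : ℝ) * ((2 * (k + 1)).choose (n + 1) : ℝ)) := by
  apply Real.le_sqrt_of_sq_le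
  rw [← sum_antidiagonal_sq_mul_choose, ← sum_antidiagonal_choose_mul]
  refine Finset.sum_sq_le_sum_mul_sum_of_sq_le_mul _ (fun p _ => by positivity)
    (fun p _ => by positivity) fun p _ => le_of_eq ?_
  rw [mul_pow, sq_abs]
  ring

/-- A value is at most the total variation along its antidiagonal. By `choose_mul_choose_sub_shift`
the increments are `p.2 - p.1` times weights, so this variation is a first absolute moment, which
the variance controls. The maximum is thus smaller than the total by a factor of order `k ^ (-1/2)`,
without Stirling's formula. -/
theorem choose_mul_choose_le (k i b : ℕ) :
    (k.choose i : ℝ) * (k.choose b : ℝ)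
      ≤ √(2 * ((2 * k).choose (i + b) : ℝ) * ((2 * (k + 1)).choose (i + b + 1) : ℝ) / (k + 1)) := by
  have hk : (0 : ℝ) < (k : ℝ) + 1 := by positivity
  set w : ℕ × ℕ → ℝ := fun p => |(p.2 : ℝ) - p.1| *
        (((k + 1).choose p.1 : ℝ) * ((k + 1).choose p.2 : ℝ)) with hw
  have hw0 : ∀ p, 0 ≤ w p := fun p => by positivity
  -- Telescoping down to `i = 0`, where the value itself is the single term `w (0, b + 1)`.
  have key : ∀ i b : ℕ, ((k : ℝ) + 1) * ((k.choose i : ℝ) * (k.choose b : ℝ))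
      ≤ ∑ j ∈ Finset.range (i + 1), w (j, i + b + 1 - j) := by
    intro i
    induction i with
    | zero =>
      intro b
      have h := choose_mul_choose_succ_sub k 0 (b + 1)
      have h2 := Nat.choose_succ_succ' k b
      have : ((k : ℝ) + 1) * ((k.choose 0 : ℝ) * (k.choose b : ℝ)) ≤ w (0, 0 + b + 1) := by
        have h3 : ((k : ℝ) + 1) * ((k.choose 0 : ℝ) * (k.choose b : ℝ)) =
          (((b + 1 : ℕ) : ℝ) - (0 : ℕ)) * (((k + 1).choose 0 : ℝ) * ((k + 1).choose (b + 1) : ℝ)) := by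
          rw [← h, h2]; push_cast; simp
        rw [h3, hw]
        simp only [zero_add]
        gcongr
        exact le_abs_self _
      simpa using this
    | succ i ih =>
      intro b
      rw [Finset.sum_range_succ]
      have h := choose_mul_choose_sub_shift k i b
      have h1 := ih (b + 1)
      have e : i + 1 + b + 1 - (i + 1) = b + 1 := by omega
      rw [e, show i + 1 + b + 1 = i + (b + 1) + 1 by ring]
      have h3 : ((b : ℝ) - i) * (((k + 1).choose (i + 1) : ℝ) * ((k + 1).choose (b + 1) : ℝ))
          ≤ w (i + 1, b + 1) := by
        rw [hw]
        simp only
        gcongr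
        push_cast
        rw [add_sub_add_right_eq_sub]
        exact le_abs_self _
      linarith
  have h1 : ((k : ℝ) + 1) * ((k.choose i : ℝ) * (k.choose b : ℝ))
      ≤ √(2 * (k + 1) * ((2 * k).choose (i + b) : ℝ) * ((2 * (k + 1)).choose (i + b + 1) : ℝ)) := by
    refine (key i b).trans (le_trans ?_ (sum_antidiagonal_abs_mul_choose_le k (i + b)))
    rw [Finset.Nat.sum_antidiagonal_eq_sum_range_succ_mk]
    refine Finset.sum_le_sum_of_subset_of_nonneg ?_ fun j _ _ => hw0 _
    intro j hj
    simp only [Finset.mem_range] at *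
    omega
  apply Real.le_sqrt_of_sq_le
  rw [le_div_iff₀ hk]
  rw [Real.le_sqrt (by positivity) (by positivity)] at h1
  refine le_of_mul_le_mul_left ?_ hk
  linarith

/-- Each difference is `(p.2 - p.1) / (k + 1)` times a weight. In its square, one copy of the weight
is bounded by the maximum `S`, and the other is summed against the second moment. -/
theorem sum_sq_choose_sub_le (k n : ℕ) :
    ∑ p ∈ Finset.HasAntidiagonal.antidiagonal n,
        ((k.choose p.1 : ℝ) * ((k + 1).choose p.2 : ℝ)
          - ((k + 1).choose p.1 : ℝ) * (k.choose p.2 : ℝ)) ^ 2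
      ≤ 2 / (k + 1) * √(2 * ((2 * (k + 1)).choose n : ℝ) *
          ((2 * (k + 1 + 1)).choose (n + 1) : ℝ) / (k + 1 + 1)) * ((2 * k).choose (n - 1) : ℝ) := by
  have hk : (0 : ℝ) < (k : ℝ) + 1 := by positivity
  set S := √(2 * ((2 * (k + 1)).choose n : ℝ) *
          ((2 * (k + 1 + 1)).choose (n + 1) : ℝ) / (k + 1 + 1)) with hS
  have hW : ∀ p ∈ Finset.HasAntidiagonal.antidiagonal n,
      ((k + 1).choose p.1 : ℝ) * ((k + 1).choose p.2 : ℝ) ≤ S := by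
    intro p hp
    rw [Finset.HasAntidiagonal.mem_antidiagonal] at hp
    have := choose_mul_choose_le (k + 1) p.1 p.2
    rw [hp] at this
    push_cast at this
    exact this
  have hD : ∀ p : ℕ × ℕ, (k.choose p.1 : ℝ) * ((k + 1).choose p.2 : ℝ)
          - ((k + 1).choose p.1 : ℝ) * (k.choose p.2 : ℝ)
        = ((p.2 : ℝ) - p.1) * (((k + 1).choose p.1 : ℝ) * ((k + 1).choose p.2 : ℝ)) / (k + 1) := by
    intro p
    rw [eq_div_iff hk.ne', ← choose_mul_choose_succ_sub]
    ring
  cases n with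
  -- The only term vanishes here, so the truncated `n - 1` on the right does no harm.
  | zero =>
    rw [Finset.Nat.antidiagonal_zero, Finset.sum_singleton]
    refine le_trans (le_of_eq ?_) (by positivity : (0 : ℝ) ≤ _)
    simp
  | succ n =>
    calc _ ≤ ∑ p ∈ Finset.HasAntidiagonal.antidiagonal (n + 1), S / (k + 1) ^ 2 * (((p.2 : ℝ) - p.1) ^ 2 *
        (((k + 1).choose p.1 : ℝ) * ((k + 1).choose p.2 : ℝ))) := by
          refine Finset.sum_le_sum fun p hp => ?_
          rw [hD p, div_pow, div_mul_eq_mul_div]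
          gcongr
          rw [mul_pow, sq (((k + 1).choose p.1 : ℝ) * _), ← mul_assoc, mul_comm]
          exact mul_le_mul_of_nonneg_right (hW p hp) (by positivity)
      _ = _ := by
          rw [← Finset.mul_sum, sum_antidiagonal_sq_mul_choose]
          simp only [Nat.add_sub_cancel]
          field_simp

theorem choose_le_choose_add_two (N n : ℕ) : N.choose (n - 1) ≤ (N + 2).choose (n + 1) := by
  cases n with
  | zero => simp
  | succ n =>
    simp only [Nat.add_sub_cancel]
    rw [Nat.choose_succ_succ' (N + 1), Nat.choose_succ_succ' N n]
    omega

/-- When a fraction `c` of the `2 * (k + 1)` blocks is invisible, the neighbouring binomial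
coefficients are comparable up to powers of `c`, and the order `k ^ (-3/2)` becomes explicit. -/
theorem sum_sq_choose_sub_le_of_le {c : ℝ} (hc : 0 < c) (k n : ℕ)
    (h : c * (2 * (k + 1)) ≤ 2 * (k + 1) - (n + 1)) :
    ∑ p ∈ Finset.HasAntidiagonal.antidiagonal n,
        ((k.choose p.1 : ℝ) * ((k + 1).choose p.2 : ℝ)
          - ((k + 1).choose p.1 : ℝ) * (k.choose p.2 : ℝ)) ^ 2
      ≤ 2 * √(2 / c ^ 3) / c / ((k + 1) * √(k + 1)) *
          (((2 * (k + 1)).choose (n + 1) : ℝ) * ((2 * k + 1).choose (n + 1) : ℝ)) := by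
  set a : ℝ := ((2 * (k + 1)).choose (n + 1) : ℝ) with ha
  have hk : (0 : ℝ) < (k : ℝ) + 1 := by positivity
  have ha0 : 0 ≤ a := by positivity
  have hn : n + 1 < 2 * (k + 1) := by
    have : ((n + 1 : ℕ) : ℝ) < ((2 * (k + 1) : ℕ) : ℝ) := by push_cast; nlinarith
    exact_mod_cast this
  have h1 : ((2 * k).choose (n - 1) : ℝ) ≤ a := by
    rw [ha]
    exact_mod_cast choose_le_choose_add_two (2 * k) n
  have h2 : c * a ≤ ((2 * k + 1).choose (n + 1) : ℝ) := by
    have e := succ_mul_choose_cast (2 * k + 1) (n + 1)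
    rw [show 2 * k + 1 + 1 = 2 * (k + 1) by ring, ← ha] at e
    push_cast at e
    have : c * (2 * (k + 1)) * a ≤ (2 * (k + 1) - (n + 1)) * a := by gcongr
    nlinarith
  have h3 : c * ((2 * (k + 1)).choose n : ℝ) ≤ a := by
    have e : ((2 * (k + 1)).choose (n + 1) : ℝ) * (n + 1) = ((2 * (k + 1)).choose n : ℝ) * (2 * (k + 1) - n) := by
      have := Nat.choose_succ_right_eq (2 * (k + 1)) n
      have h5 : ((2 * (k + 1) - n : ℕ) : ℝ) = 2 * (k + 1) - n := by
        rw [Nat.cast_sub (by omega)]; push_cast; ring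
      rw [← h5]
      exact_mod_cast this
    rw [← ha] at e
    have hb : (0 : ℝ) ≤ ((2 * (k + 1)).choose n : ℝ) := by positivity
    have hn' : (n : ℝ) + 1 ≤ 2 * (k + 1) := by exact_mod_cast hn.le
    have : c * (2 * (k + 1)) * ((2 * (k + 1)).choose n : ℝ) ≤ a * (2 * (k + 1)) := by
      calc _ ≤ (2 * (k + 1) - n : ℝ) * ((2 * (k + 1)).choose n : ℝ) := by gcongr; linarith
        _ = a * (n + 1) := by linarith
        _ ≤ _ := by gcongr
    nlinarith
  have h4 : c ^ 2 * ((2 * (k + 1 + 1)).choose (n + 1) : ℝ) ≤ a := by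
    have e := succ_mul_choose_cast (2 * (k + 1)) (n + 1)
    have e' := succ_mul_choose_cast (2 * (k + 1) + 1) (n + 1)
    rw [show 2 * (k + 1) + 1 + 1 = 2 * (k + 1 + 1) by ring] at e'
    rw [← ha] at e
    set b : ℝ := ((2 * (k + 1) + 1).choose (n + 1) : ℝ)
    set d : ℝ := ((2 * (k + 1 + 1)).choose (n + 1) : ℝ)
    push_cast at e e'
    have hb : 0 ≤ b := by positivity
    have hd : 0 ≤ d := by positivity
    have hn0 : (0 : ℝ) ≤ n := by positivity
    have hc1 : c ≤ 1 := by nlinarith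
    have i1 : c * b ≤ a := by
      have : c * (2 * (k + 1) + 1) * b ≤ (2 * (k + 1) + 1 - (n + 1)) * b := by
        gcongr; linarith
      nlinarith
    have i2 : c * d ≤ b := by
      have : c * (2 * (k + 1) + 2) * d ≤ (2 * (k + 1) + 1 + 1 - (n + 1)) * d := by
        gcongr; linarith
      nlinarith
    nlinarith
  have hS : √(2 * ((2 * (k + 1)).choose n : ℝ) *
          ((2 * (k + 1 + 1)).choose (n + 1) : ℝ) / (k + 1 + 1)) ≤ √(2 / c ^ 3) * a / √(k + 1) := by
    rw [show √(2 / c ^ 3) * a / √(k + 1) = √(2 / c ^ 3 * a ^ 2 / (k + 1)) by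
      rw [Real.sqrt_div' _ hk.le, Real.sqrt_mul (by positivity), Real.sqrt_sq ha0]]
    apply Real.sqrt_le_sqrt
    have : (c * ((2 * (k + 1)).choose n : ℝ)) * (c ^ 2 * ((2 * (k + 1 + 1)).choose (n + 1) : ℝ)) ≤ a * a := by
      gcongr
    rw [div_le_div_iff₀ (by positivity) hk, div_mul_eq_mul_div, div_mul_eq_mul_div, le_div_iff₀ (by positivity)]
    have h6 : (0 : ℝ) ≤ k := by positivity
    have : (c * ((2 * (k + 1)).choose n : ℝ)) * (c ^ 2 * ((2 * (k + 1 + 1)).choose (n + 1) : ℝ)) * (k + 1) ≤ a * a * (k + 1 + 1) := by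
      gcongr; linarith
    linarith
  calc _ ≤ _ := sum_sq_choose_sub_le k n
    _ ≤ 2 / (k + 1) * (√(2 / c ^ 3) * a / √(k + 1)) * (((2 * k + 1).choose (n + 1) : ℝ) / c) := by
      gcongr
      rw [le_div_iff₀ hc]
      calc _ ≤ a * c := by gcongr
        _ ≤ _ := by linarith
    _ = _ := by
      field_simp

/-! ### Laws of words of visible letters and their affinity. -/

theorem sum_fin_cons {A : Type*} [Fintype A] (ℓ : ℕ) (H : (Fin (ℓ + 1) → A) → ℝ) :
    ∑ s : Fin (ℓ + 1) → A, H s = ∑ a : A, ∑ s : Fin ℓ → A, H (Fin.cons a s) := by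
  rw [← Fintype.sum_prod_type' (f := fun a s => H (Fin.cons a s))]
  exact (Fintype.sum_equiv (Fin.consEquiv fun _ => A) _ _ fun _ => rfl).symm

section Symbols

variable {A : Type}

/-- The weight of a word whose letters carry the weights `w`. -/
def wordWeight (w : A → ℝ) {ℓ : ℕ} (s : Fin ℓ → A) : ℝ := ∏ i, w (s i)

theorem wordWeight_cons (w : A → ℝ) {ℓ : ℕ} (a : A) (s : Fin ℓ → A) :
    wordWeight w (Fin.cons a s : Fin (ℓ + 1) → A) = w a * wordWeight w s := by
  simp [wordWeight, Fin.prod_univ_succ]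

theorem sum_wordWeight [Fintype A] (w : A → ℝ) (ℓ : ℕ) :
    ∑ s : Fin ℓ → A, wordWeight w s = (∑ a, w a) ^ ℓ := by
  rw [Fintype.sum_pow]; rfl

theorem sum_wordWeight_mul [Fintype A] (w ρ : A → ℝ) (h : ∑ a, w a * ρ a = ∑ a, w a) {ℓ : ℕ} (i : Fin ℓ) :
    ∑ s : Fin ℓ → A, wordWeight w s * ρ (s i) = (∑ a, w a) ^ ℓ := by
  have e : ∀ s : Fin ℓ → A, wordWeight w s * ρ (s i)
      = ∏ j, w (s j) * (if j = i then ρ (s j) else 1) := by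
    intro s
    rw [Finset.prod_mul_distrib, Finset.prod_ite_eq' Finset.univ i]
    simp [wordWeight]
  simp_rw [e]
  have := (Finset.prod_univ_sum (fun _ : Fin ℓ => (Finset.univ : Finset A))
    (fun j a => w a * (if j = i then ρ a else 1))).symm
  rw [Fintype.piFinset_univ] at this
  rw [this, Finset.prod_eq_pow_card (b := ∑ a, w a)]
  · simp
  · intro j _
    split_ifs
    · exact h
    · simp

/-- The variance of a linear statistic of independent centred letters. -/
theorem sum_wordWeight_mul_sq [Fintype A] (w ξ : A → ℝ) (h : ∑ a, w a * ξ a = 0) (ℓ : ℕ) (d : Fin ℓ → ℝ) :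
    (∑ a, w a) * ∑ s : Fin ℓ → A, wordWeight w s * (∑ i, d i * ξ (s i)) ^ 2
      = (∑ a, w a) ^ ℓ * (∑ a, w a * ξ a ^ 2) * ∑ i, d i ^ 2 := by
  induction ℓ with
  | zero => simp
  | succ ℓ ih =>
    rw [sum_fin_cons]
    simp only [Fin.sum_univ_succ, wordWeight_cons, Fin.cons_zero, Fin.cons_succ]
    have e : ∀ (a : A) (s : Fin ℓ → A), w a * wordWeight w s *
          (d 0 * ξ a + ∑ i, d (Fin.succ i) * ξ (s i)) ^ 2
        = d 0 ^ 2 * (w a * ξ a ^ 2) * wordWeight w s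
          + (w a * ξ a) * (2 * d 0 * wordWeight w s * ∑ i, d (Fin.succ i) * ξ (s i))
          + w a * (wordWeight w s * (∑ i, d (Fin.succ i) * ξ (s i)) ^ 2) := by
      intro a s; ring
    simp_rw [e, Finset.sum_add_distrib, ← Finset.mul_sum, ← Finset.sum_mul, h, sum_wordWeight]
    have := ih fun i => d i.succ
    rw [← Finset.mul_sum, zero_mul, add_zero, mul_add, mul_left_comm (∑ a, w a) (∑ a, w a), this]
    ring

/-- Words of at most `N` letters. -/
abbrev Words (A : Type) (N : ℕ) : Type := Σ ℓ : Fin (N + 1), Fin (ℓ : ℕ) → A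

/-- The likelihood ratio, up to normalization, of the visible word when a defect follows `j` and
precedes `j'` regular blocks. -/
def defectRatio (ρ : A → ℝ) (j j' : ℕ) {ℓ : ℕ} (s : Fin ℓ → A) : ℝ :=
  ((j + j').choose ℓ : ℝ) + ∑ i : Fin ℓ, (j.choose i : ℝ) * (j'.choose (ℓ - 1 - i) : ℝ) * ρ (s i)

/-- The law of the visible word of `j` regular blocks, a defect and `j'` regular blocks. -/
def defectLaw (e : ℝ) (w ρ : A → ℝ) (j j' : ℕ) {ℓ : ℕ} (s : Fin ℓ → A) : ℝ :=
  e ^ (j + j' + 1) * wordWeight w s * defectRatio ρ j j' s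

theorem sum_choose_mul_choose_fin (j j' ℓ : ℕ) :
    ((j + j').choose ℓ : ℝ) + ∑ i : Fin ℓ, (j.choose i : ℝ) * (j'.choose (ℓ - 1 - i) : ℝ)
      = ((j + j' + 1).choose ℓ : ℝ) := by
  cases ℓ with
  | zero => simp
  | succ n =>
    rw [Nat.choose_succ_succ' (j + j') n, Nat.add_choose_eq j j' n,
      Finset.Nat.sum_antidiagonal_eq_sum_range_succ_mk,
      Fin.sum_univ_eq_sum_range (fun i => (j.choose i : ℝ) * (j'.choose (n + 1 - 1 - i) : ℝ))]
    push_cast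
    rw [add_comm]

theorem sum_defectLaw [Fintype A] (e : ℝ) (w ρ : A → ℝ) (h : ∑ a, w a * ρ a = ∑ a, w a) (j j' ℓ : ℕ) :
    ∑ s : Fin ℓ → A, defectLaw e w ρ j j' s
      = e ^ (j + j' + 1) * ((j + j' + 1).choose ℓ : ℝ) * (∑ a, w a) ^ ℓ := by
  have h1 : ∀ s : Fin ℓ → A, defectLaw e w ρ j j' s = e ^ (j + j' + 1) *
      (((j + j').choose ℓ : ℝ) * wordWeight w s + ∑ i : Fin ℓ,
        (j.choose i : ℝ) * (j'.choose (ℓ - 1 - i) : ℝ) * (wordWeight w s * ρ (s i))) := by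
    intro s
    rw [defectLaw, defectRatio, mul_assoc, mul_add, Finset.mul_sum, mul_comm (wordWeight w s)]
    congr 2
    exact Finset.sum_congr rfl fun i _ => by ring
  simp_rw [h1]
  rw [← Finset.mul_sum, Finset.sum_add_distrib, Finset.sum_comm, ← Finset.mul_sum, sum_wordWeight]
  simp_rw [← Finset.mul_sum, sum_wordWeight_mul w ρ h]
  rw [← Finset.sum_mul, ← add_mul, sum_choose_mul_choose_fin, mul_assoc]

/-- The loss `(√P - √Q)² / 2` is `(P - Q)² / (2 * (√P + √Q)²)`. A common lower bound `L` thus turns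
Hellinger distance into a chi-square quantity. -/
theorem le_sqrt_mul_of_le {P Q L : ℝ} (hL : 0 < L) (hP : L ≤ P) (hQ : L ≤ Q) :
    (P + Q) / 2 - (P - Q) ^ 2 / (4 * L) ≤ √(P * Q) := by
  have hP0 := hL.trans_le hP
  have hQ0 := hL.trans_le hQ
  have h1 : (√P - √Q) ^ 2 ≤ (P - Q) ^ 2 / (2 * L) := by
    rw [le_div_iff₀ (by positivity)]
    have e : (P - Q) ^ 2 = (√P - √Q) ^ 2 * (√P + √Q) ^ 2 := by
      rw [← mul_pow, ← Real.sq_sqrt hP0.le, ← Real.sq_sqrt hQ0.le]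
      simp only [Real.sqrt_sq_eq_abs, abs_of_nonneg (Real.sqrt_nonneg _)]
      ring
    rw [e]
    gcongr
    nlinarith [Real.sq_sqrt hP0.le, Real.sq_sqrt hQ0.le, Real.sqrt_nonneg P, Real.sqrt_nonneg Q,
      mul_nonneg (Real.sqrt_nonneg P) (Real.sqrt_nonneg Q)]
  rw [Real.sqrt_mul hP0.le]
  have h2 : (P - Q) ^ 2 / (2 * L) = 2 * ((P - Q) ^ 2 / (4 * L)) := by field_simp; ring
  nlinarith [Real.sq_sqrt hP0.le, Real.sq_sqrt hQ0.le]

theorem sum_fin_choose_sub_sq (k n : ℕ) :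
    ∑ i : Fin (n + 1), ((k.choose i : ℝ) * ((k + 1).choose (n + 1 - 1 - i) : ℝ)
        - ((k + 1).choose i : ℝ) * (k.choose (n + 1 - 1 - i) : ℝ)) ^ 2
      = ∑ p ∈ Finset.HasAntidiagonal.antidiagonal n,
        ((k.choose p.1 : ℝ) * ((k + 1).choose p.2 : ℝ)
          - ((k + 1).choose p.1 : ℝ) * (k.choose p.2 : ℝ)) ^ 2 := by
  rw [Finset.Nat.sum_antidiagonal_eq_sum_range_succ_mk,
    Fin.sum_univ_eq_sum_range (fun i => ((k.choose i : ℝ) * ((k + 1).choose (n + 1 - 1 - i) : ℝ)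
        - ((k + 1).choose i : ℝ) * (k.choose (n + 1 - 1 - i) : ℝ)) ^ 2)]
  simp

theorem defectRatio_sub (ρ : A → ℝ) (k : ℕ) {ℓ : ℕ} (s : Fin ℓ → A) :
    defectRatio ρ k (k + 1) s - defectRatio ρ (k + 1) k s
      = ∑ i : Fin ℓ, ((k.choose i : ℝ) * ((k + 1).choose (ℓ - 1 - i) : ℝ)
        - ((k + 1).choose i : ℝ) * (k.choose (ℓ - 1 - i) : ℝ)) * (ρ (s i) - 1) := by
  have h1 := sum_choose_mul_choose_fin k (k + 1) ℓ
  have h2 := sum_choose_mul_choose_fin (k + 1) k ℓ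
  rw [show k + 1 + k = k + (k + 1) by ring] at h2
  simp only [defectRatio, mul_sub, sub_mul, Finset.sum_sub_distrib, mul_one]
  rw [show k + 1 + k = k + (k + 1) by ring]
  linarith

theorem le_defectLaw {e : ℝ} {w ρ : A → ℝ} (he : 0 < e) (hw : ∀ a, 0 < w a) (hρ : ∀ a, 0 ≤ ρ a)
    (j j' : ℕ) {ℓ : ℕ} (s : Fin ℓ → A) :
    e ^ (j + j' + 1) * wordWeight w s * ((j + j').choose ℓ : ℝ) ≤ defectLaw e w ρ j j' s := by
  have : 0 < wordWeight w s := Finset.prod_pos fun i _ => hw _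
  rw [defectLaw, defectRatio]
  gcongr
  exact le_add_of_nonneg_right (Finset.sum_nonneg fun i _ => mul_nonneg (by positivity) (hρ _))

theorem defectLaw_nonneg {e : ℝ} {w ρ : A → ℝ} (he : 0 < e) (hw : ∀ a, 0 < w a)
    (hρ : ∀ a, 0 ≤ ρ a) (j j' : ℕ) {ℓ : ℕ} (s : Fin ℓ → A) : 0 ≤ defectLaw e w ρ j j' s := by
  refine le_trans ?_ (le_defectLaw he hw hρ j j' s)
  have : 0 < wordWeight w s := Finset.prod_pos fun i _ => hw _
  positivity

/-- The words whose defect is invisible contribute equally to both laws and serve as the common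
lower bound. The chi-square loss relative to it is the variance of the linear statistic with
coefficients `D i`. -/
theorem affinity_defectLaw_of_good [Fintype A] {e c : ℝ} {w ρ : A → ℝ} (he : 0 < e) (hc : 0 < c)
    (hw : ∀ a, 0 < w a) (hρ : ∀ a, 0 ≤ ρ a) (h : ∑ a, w a * ρ a = ∑ a, w a) (hw0 : 0 < ∑ a, w a)
    (k ℓ : ℕ) (hℓ : c * (2 * (k + 1)) ≤ 2 * (k + 1) - ℓ) :
    e ^ (2 * (k + 1)) * ((2 * (k + 1)).choose ℓ : ℝ) * (∑ a, w a) ^ ℓ *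
        (1 - (∑ a, w a * (ρ a - 1) ^ 2) / (4 * ∑ a, w a) *
          (2 * √(2 / c ^ 3) / c) / ((k + 1) * √(k + 1)))
      ≤ ∑ s : Fin ℓ → A, √(defectLaw e w ρ k (k + 1) s * defectLaw e w ρ (k + 1) k s) := by
  set t := ∑ a, w a with ht
  set σ := ∑ a, w a * (ρ a - 1) ^ 2 with hσ
  set K := 2 * √(2 / c ^ 3) / c with hK
  have hσ0 : 0 ≤ σ := Finset.sum_nonneg fun a _ => mul_nonneg (hw a).le (sq_nonneg _)
  have hk : (0 : ℝ) < (k : ℝ) + 1 := by positivity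
  have hlt : ℓ < 2 * (k + 1) := by
    have : (ℓ : ℝ) < ((2 * (k + 1) : ℕ) : ℝ) := by push_cast; nlinarith
    exact_mod_cast this
  have hC : 0 < ((2 * k + 1).choose ℓ : ℝ) := by
    exact_mod_cast Nat.choose_pos (by omega)
  set D : Fin ℓ → ℝ := fun i => (k.choose i : ℝ) * ((k + 1).choose (ℓ - 1 - i) : ℝ)
        - ((k + 1).choose i : ℝ) * (k.choose (ℓ - 1 - i) : ℝ) with hD
  have hD2 : ∑ i, D i ^ 2 ≤ K / ((k + 1) * √(k + 1)) *
      (((2 * (k + 1)).choose ℓ : ℝ) * ((2 * k + 1).choose ℓ : ℝ)) := by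
    cases ℓ with
    | zero =>
      simp only [Finset.univ_eq_empty, Finset.sum_empty]
      positivity
    | succ n =>
      rw [hD, sum_fin_choose_sub_sq]
      exact sum_sq_choose_sub_le_of_le hc k n (by push_cast at hℓ; exact hℓ)
  have e1 : k + (k + 1) + 1 = 2 * (k + 1) := by ring
  have e2 : k + 1 + k + 1 = 2 * (k + 1) := by ring
  have e3 : k + (k + 1) = 2 * k + 1 := by ring
  have e4 : k + 1 + k = 2 * k + 1 := by ring
  have hpt : ∀ s : Fin ℓ → A,
      (defectLaw e w ρ k (k + 1) s + defectLaw e w ρ (k + 1) k s) / 2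
        - e ^ (2 * (k + 1)) / (4 * ((2 * k + 1).choose ℓ : ℝ)) *
          (wordWeight w s * (∑ i, D i * (ρ (s i) - 1)) ^ 2)
      ≤ √(defectLaw e w ρ k (k + 1) s * defectLaw e w ρ (k + 1) k s) := by
    intro s
    have hws : 0 < wordWeight w s := Finset.prod_pos fun i _ => hw _
    have l1 := le_defectLaw he hw hρ k (k + 1) s
    have l2 := le_defectLaw he hw hρ (k + 1) k s
    rw [e1, e3] at l1
    rw [e2, e4] at l2
    refine le_trans (le_of_eq ?_) (le_sqrt_mul_of_le (by positivity) l1 l2)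
    congr 1
    rw [← defectRatio_sub]
    have : defectLaw e w ρ k (k + 1) s - defectLaw e w ρ (k + 1) k s
      = e ^ (2 * (k + 1)) * wordWeight w s *
        (defectRatio ρ k (k + 1) s - defectRatio ρ (k + 1) k s) := by
      rw [defectLaw, defectLaw, e1, e2]; ring
    rw [this]
    field_simp
  refine le_trans ?_ (Finset.sum_le_sum fun s _ => hpt s)
  rw [Finset.sum_sub_distrib, ← Finset.sum_div, Finset.sum_add_distrib, sum_defectLaw e w ρ h,
    sum_defectLaw e w ρ h, ← Finset.mul_sum, e1, e2, ← ht]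
  have hv := sum_wordWeight_mul_sq w (fun a => ρ a - 1) (by simp [mul_sub, h, ht]) ℓ D
  rw [← ht] at hv
  have hv' : ∑ s : Fin ℓ → A, wordWeight w s * (∑ i, D i * (ρ (s i) - 1)) ^ 2
      = t ^ ℓ * σ * (∑ i, D i ^ 2) / t := by
    rw [eq_div_iff hw0.ne', mul_comm, hv]
  rw [hv']
  have hb : e ^ (2 * (k + 1)) / (4 * ((2 * k + 1).choose ℓ : ℝ)) *
      (t ^ ℓ * σ * (∑ i, D i ^ 2) / t) ≤
      e ^ (2 * (k + 1)) / (4 * ((2 * k + 1).choose ℓ : ℝ)) *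
      (t ^ ℓ * σ * (K / ((k + 1) * √(k + 1)) *
      (((2 * (k + 1)).choose ℓ : ℝ) * ((2 * k + 1).choose ℓ : ℝ))) / t) := by
    gcongr
  have he' : e ^ (2 * (k + 1)) / (4 * ((2 * k + 1).choose ℓ : ℝ)) *
      (t ^ ℓ * σ * (K / ((k + 1) * √(k + 1)) *
      (((2 * (k + 1)).choose ℓ : ℝ) * ((2 * k + 1).choose ℓ : ℝ))) / t)
      = e ^ (2 * (k + 1)) * ((2 * (k + 1)).choose ℓ : ℝ) * t ^ ℓ *
        (σ / (4 * t) * K / ((k + 1) * √(k + 1))) := by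
    field_simp
  rw [he'] at hb
  rw [mul_sub, mul_one]
  linarith

/-- A lower-tail bound for the number of invisible blocks. -/
theorem sum_binomial_tail_le {e t : ℝ} (he : 0 < e) (ht : 0 < t) (het : e * (1 + t) = 1) (N : ℕ) :
    ∑ ℓ ∈ Finset.range (N + 1), (if e / 4 * N ≤ N - ℓ then 0 else
        e ^ N * (N.choose ℓ : ℝ) * t ^ ℓ) ≤ Real.exp (-(e / 4 * N)) := by
  have h1 : ∀ ℓ ∈ Finset.range (N + 1), (if e / 4 * N ≤ N - ℓ then 0 else
        e ^ N * (N.choose ℓ : ℝ) * t ^ ℓ) ≤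
      Real.exp (e / 4 * N) * e ^ N * (t ^ ℓ * (Real.exp (-1)) ^ (N - ℓ) * (N.choose ℓ : ℝ)) := by
    intro ℓ hℓ
    have hℓ' : ℓ ≤ N := by simpa [Nat.lt_succ_iff] using hℓ
    split_ifs with hc
    · positivity
    -- Chernoff's method: on the tail this factor is at least 1, so it may be inserted; the sum is
    -- then a binomial expansion.
    · have : 1 ≤ Real.exp (e / 4 * N) * (Real.exp (-1)) ^ (N - ℓ) := by
        rw [← Real.exp_nat_mul, ← Real.exp_add, Real.one_le_exp_iff, Nat.cast_sub hℓ']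
        push Not at hc
        linarith
      calc _ = e ^ N * (N.choose ℓ : ℝ) * t ^ ℓ * 1 := by ring
        _ ≤ e ^ N * (N.choose ℓ : ℝ) * t ^ ℓ * (Real.exp (e / 4 * N) * (Real.exp (-1)) ^ (N - ℓ)) := by
          gcongr
        _ = _ := by ring
  refine (Finset.sum_le_sum h1).trans ?_
  rw [← Finset.mul_sum, ← add_pow, mul_assoc, ← mul_pow]
  have h2 : e * (t + Real.exp (-1)) ≤ Real.exp (-(e / 2)) := by
    have h3 : Real.exp (-1) ≤ 1 / 2 := by
      rw [Real.exp_neg, inv_le_comm₀ (Real.exp_pos _) (by norm_num)]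
      have := Real.add_one_le_exp 1
      norm_num at *
      linarith
    have := Real.add_one_le_exp (-(e / 2))
    nlinarith
  calc _ ≤ Real.exp (e / 4 * N) * Real.exp (-(e / 2)) ^ N := by
        gcongr
    _ = _ := by
      rw [← Real.exp_nat_mul, ← Real.exp_add]
      congr 1
      ring

theorem exists_le_affinity_defectLaw [Fintype A] {e : ℝ} {w ρ : A → ℝ} (he : 0 < e)
    (hw : ∀ a, 0 < w a) (hρ : ∀ a, 0 ≤ ρ a) (h : ∑ a, w a * ρ a = ∑ a, w a) (hw0 : 0 < ∑ a, w a)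
    (het : e * (1 + ∑ a, w a) = 1) :
    ∃ K : ℝ, 0 < K ∧ ∀ k : ℕ, 1 - K / ((k + 1) * √(k + 1)) ≤
      ∑ ω : Words A (2 * (k + 1)), √(defectLaw e w ρ k (k + 1) ω.2 * defectLaw e w ρ (k + 1) k ω.2) := by
  set t := ∑ a, w a with ht
  set σ := ∑ a, w a * (ρ a - 1) ^ 2 with hσ
  have hσ0 : 0 ≤ σ := Finset.sum_nonneg fun a _ => mul_nonneg (hw a).le (sq_nonneg _)
  set K₁ := σ / (4 * t) * (2 * √(2 / (e / 4) ^ 3) / (e / 4)) with hK₁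
  have hK₁0 : 0 ≤ K₁ := by positivity
  refine ⟨K₁ + 8 / e ^ 2, by positivity, fun k => ?_⟩
  have hk : (0 : ℝ) < (k : ℝ) + 1 := by positivity
  set N := 2 * (k + 1) with hN
  set δ := K₁ / ((k + 1) * √(k + 1)) with hδ
  have hδ0 : 0 ≤ δ := by positivity
  set b : ℕ → ℝ := fun ℓ => e ^ N * (N.choose ℓ : ℝ) * t ^ ℓ with hb
  have hb0 : ∀ ℓ, 0 ≤ b ℓ := fun ℓ => by positivity
  have hsum : ∑ ℓ ∈ Finset.range (N + 1), b ℓ = 1 := by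
    have := add_pow t 1 N
    calc _ = e ^ N * (t + 1) ^ N := by
          rw [this, Finset.mul_sum]
          exact Finset.sum_congr rfl fun i _ => by rw [hb]; ring
      _ = 1 := by rw [← mul_pow, add_comm, het, one_pow]
  have hNr : (N : ℝ) = 2 * (k + 1) := by rw [hN]; push_cast; ring
  rw [Fintype.sum_sigma, Fin.sum_univ_eq_sum_range (fun ℓ => ∑ s : Fin ℓ → A,
    √(defectLaw e w ρ k (k + 1) s * defectLaw e w ρ (k + 1) k s))]
  have hpt : ∀ ℓ ∈ Finset.range (N + 1), b ℓ - δ * b ℓ - (if e / 4 * N ≤ N - ℓ then 0 else b ℓ)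
      ≤ ∑ s : Fin ℓ → A, √(defectLaw e w ρ k (k + 1) s * defectLaw e w ρ (k + 1) k s) := by
    intro ℓ _
    split_ifs with hc
    · rw [hNr] at hc
      -- The threshold `e / 4` is a quarter of the expected fraction of invisible blocks; word
      -- lengths beyond it are discarded.
      have := affinity_defectLaw_of_good he (by positivity : 0 < e / 4) hw hρ h hw0 k ℓ hc
      refine le_trans (le_of_eq ?_) this
      simp only [hb, hδ, hK₁]
      ring
    · refine le_trans ?_ (Finset.sum_nonneg fun s _ => Real.sqrt_nonneg _)
      nlinarith [hb0 ℓ, mul_nonneg hδ0 (hb0 ℓ)]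
  refine le_trans ?_ (Finset.sum_le_sum hpt)
  rw [Finset.sum_sub_distrib, Finset.sum_sub_distrib, ← Finset.mul_sum, hsum]
  have htail := sum_binomial_tail_le he hw0 het N
  -- From `x ^ 2 / 2 ≤ exp x` at `x = e * (k + 1) / 2`, which gives the constant `8 / e ^ 2`.
  have hexp : Real.exp (-(e / 4 * N)) ≤ 8 / e ^ 2 / ((k + 1) * √(k + 1)) := by
    have hx : 0 < e / 4 * N := by rw [hNr]; positivity
    have h1 := Real.quadratic_le_exp_of_nonneg hx.le
    have h2 : (e / 4 * N) ^ 2 / 2 ≤ Real.exp (e / 4 * N) := by linarith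
    have h3 : √((k : ℝ) + 1) ≤ k + 1 := by
      rw [Real.sqrt_le_left hk.le]
      have : (0 : ℝ) ≤ k := by positivity
      nlinarith
    rw [Real.exp_neg, div_div, inv_le_comm₀ (Real.exp_pos _) (by positivity)]
    refine le_trans ?_ h2
    rw [hNr, inv_div, div_le_iff₀ (by norm_num)]
    calc e ^ 2 * ((k + 1) * √(k + 1)) ≤ e ^ 2 * ((k + 1) * (k + 1)) := by gcongr
      _ ≤ _ := by nlinarith [sq_nonneg (e * (k + 1))]
  rw [add_div, ← hδ]
  linarith

end Symbols

/-! ### The deletion channel on concatenations of blocks. -/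

/-- The expectation of `F` at a trace of the list `l`. -/
def channel (q : ℝ) : List Bool → (List Bool → ℝ) → ℝ
  | [], F => F []
  | b :: l, F => q * channel q l F + (1 - q) * channel q l fun u => F (b :: u)

theorem channel_append (q : ℝ) (l l' : List Bool) (F : List Bool → ℝ) :
    channel q (l ++ l') F = channel q l fun u => channel q l' fun v => F (u ++ v) := by
  induction l generalizing F with
  | nil => simp [channel]
  | cons b l ih => simp [channel, ih]

section Words

variable {A : Type}

/-- The concatenation of the strings that the letters of a word stand for. -/
def wordString (φ : A → List Bool) {ℓ : ℕ} (s : Fin ℓ → A) : List Bool :=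
  (List.ofFn fun i => φ (s i)).flatten

theorem wordString_cons (φ : A → List Bool) {ℓ : ℕ} (a : A) (s : Fin ℓ → A) :
    wordString φ (Fin.cons a s : Fin (ℓ + 1) → A) = φ a ++ wordString φ s := by
  simp [wordString, List.ofFn_succ]

/-- The leading block is invisible or emits the first letter, so word weights obey a Pascal-type
recursion. The vanishing of `Q` at length `N + 1` lets both cases be summed over the same range. -/
theorem channel_block_append [Fintype A] {q e : ℝ} {φ : A → List Bool} {v : A → ℝ} {B l : List Bool} {N : ℕ}
    {Q Q' : ∀ ℓ : ℕ, (Fin ℓ → A) → ℝ}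
    (hB : ∀ F, channel q B F = e * (F [] + ∑ a, v a * F (φ a)))
    (hl : ∀ F, channel q l F =
      ∑ ℓ ∈ Finset.range (N + 1), ∑ s : Fin ℓ → A, Q ℓ s * F (wordString φ s))
    (hQ : ∀ s, Q (N + 1) s = 0) (h0 : ∀ s, Q' 0 s = e * Q 0 s)
    (h1 : ∀ ℓ a s, Q' (ℓ + 1) (Fin.cons a s) = e * (Q (ℓ + 1) (Fin.cons a s) + v a * Q ℓ s))
    (F : List Bool → ℝ) :
    channel q (B ++ l) F =
      ∑ ℓ ∈ Finset.range (N + 1 + 1), ∑ s : Fin ℓ → A, Q' ℓ s * F (wordString φ s) := by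
  rw [channel_append, hB]
  simp only [List.nil_append, hl]
  have e1 : ∑ ℓ ∈ Finset.range (N + 1), ∑ s : Fin ℓ → A, Q ℓ s * F (wordString φ s)
      = ∑ ℓ ∈ Finset.range (N + 1 + 1), ∑ s : Fin ℓ → A, Q ℓ s * F (wordString φ s) := by
    rw [Finset.sum_range_succ _ (N + 1)]
    simp [hQ]
  rw [e1, Finset.sum_range_succ' _ (N + 1), Finset.sum_range_succ' _ (N + 1)]
  simp_rw [Finset.mul_sum (Finset.range (N + 1))]
  rw [Finset.sum_comm, add_right_comm, ← Finset.sum_add_distrib, mul_add, Finset.mul_sum,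
    Finset.mul_sum]
  congr 1
  · refine Finset.sum_congr rfl fun ℓ _ => ?_
    rw [sum_fin_cons, sum_fin_cons, ← Finset.sum_add_distrib, Finset.mul_sum]
    refine Finset.sum_congr rfl fun a _ => ?_
    rw [Finset.mul_sum, ← Finset.sum_add_distrib, Finset.mul_sum]
    refine Finset.sum_congr rfl fun s _ => ?_
    rw [h1, wordString_cons]
    ring
  · refine Finset.sum_congr rfl fun s _ => ?_
    rw [h0]
    ring

/-- `n` regular blocks `01`. -/
def regularBlocks (n : ℕ) : List Bool := (List.replicate n [false, true]).flatten

theorem regularBlocks_succ (n : ℕ) : regularBlocks (n + 1) = [false, true] ++ regularBlocks n := by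
  simp [regularBlocks, List.replicate_succ]

theorem regularBlocks_succ' (n : ℕ) : regularBlocks (n + 1) = regularBlocks n ++ [false, true] := by
  simp [regularBlocks, List.replicate_succ']

theorem length_regularBlocks (n : ℕ) : (regularBlocks n).length = 2 * n := by
  induction n with
  | zero => simp [regularBlocks]
  | succ n ih => rw [regularBlocks_succ, List.length_append, ih]; simp; ring

theorem channel_regularBlocks [Fintype A] {q e : ℝ} {φ : A → List Bool} {w : A → ℝ}
    (hB : ∀ F, channel q [false, true] F = e * (F [] + ∑ a, w a * F (φ a))) (n : ℕ)
    (F : List Bool → ℝ) :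
    channel q (regularBlocks n) F = ∑ ℓ ∈ Finset.range (n + 1), ∑ s : Fin ℓ → A,
      (e ^ n * (n.choose ℓ : ℝ) * wordWeight w s) * F (wordString φ s) := by
  induction n generalizing F with
  | zero => simp [regularBlocks, channel, wordWeight, wordString]
  | succ n ih =>
    rw [regularBlocks_succ]
    refine channel_block_append (Q := fun ℓ s => e ^ n * (n.choose ℓ : ℝ) * wordWeight w s)
      (Q' := fun ℓ s => e ^ (n + 1) * ((n + 1).choose ℓ : ℝ) * wordWeight w s) hB ih ?_ ?_ ?_ F
    · intro s; simp
    · intro s; simp; ring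
    · intro ℓ a s
      rw [Nat.choose_succ_succ' n ℓ, wordWeight_cons]
      push_cast
      ring

/-- A block `1` between `j` and `j'` regular blocks. -/
def defectString (j j' : ℕ) : List Bool := regularBlocks j ++ ([true] ++ regularBlocks j')

theorem length_defectString (j j' : ℕ) : (defectString j j').length = 2 * (j + j') + 1 := by
  simp [defectString, length_regularBlocks]; ring

theorem defectString_ne (k : ℕ) : defectString k (k + 1) ≠ defectString (k + 1) k := by
  rw [defectString, defectString, regularBlocks_succ' k]
  simp

theorem defectLaw_eq_zero (e : ℝ) (w ρ : A → ℝ) (j j' : ℕ) (s : Fin (j + j' + 1 + 1) → A) :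
    defectLaw e w ρ j j' s = 0 := by
  have : defectRatio ρ j j' s = 0 := by
    rw [defectRatio, Nat.choose_eq_zero_of_lt (by omega), Finset.sum_eq_zero]
    · simp
    · intro i _
      rcases lt_or_ge j (i : ℕ) with h | h
      · rw [Nat.choose_eq_zero_of_lt h]; simp
      · rw [Nat.choose_eq_zero_of_lt (show j' < j + j' + 1 + 1 - 1 - i by omega)]; simp
  rw [defectLaw, this, mul_zero]

theorem channel_defectString [Fintype A] {q e : ℝ} {φ : A → List Bool} {w ρ : A → ℝ}
    (hB : ∀ F, channel q [false, true] F = e * (F [] + ∑ a, w a * F (φ a)))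
    (hB' : ∀ F, channel q [true] F = e * (F [] + ∑ a, w a * ρ a * F (φ a))) (j j' : ℕ)
    (F : List Bool → ℝ) :
    channel q (defectString j j') F = ∑ ℓ ∈ Finset.range (j + j' + 1 + 1), ∑ s : Fin ℓ → A,
      defectLaw e w ρ j j' s * F (wordString φ s) := by
  induction j generalizing F with
  | zero =>
    rw [show defectString 0 j' = [true] ++ regularBlocks j' by simp [defectString, regularBlocks],
      show 0 + j' + 1 + 1 = j' + 1 + 1 by ring]
    refine channel_block_append (Q := fun ℓ s => e ^ j' * (j'.choose ℓ : ℝ) * wordWeight w s)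
      (Q' := fun ℓ s => defectLaw e w ρ 0 j' s) hB' (channel_regularBlocks hB j') ?_ ?_ ?_ F
    · intro s; simp
    · intro s; simp [defectLaw, defectRatio]; ring
    · intro ℓ a s
      simp only [defectLaw, defectRatio, Fin.sum_univ_succ, wordWeight_cons]
      simp
      ring
  | succ j ih =>
    rw [show defectString (j + 1) j' = [false, true] ++ defectString j j' by
        simp [defectString, regularBlocks_succ],
      show j + 1 + j' + 1 + 1 = j + j' + 1 + 1 + 1 by ring]
    refine channel_block_append (Q := fun ℓ s => defectLaw e w ρ j j' s)
      (Q' := fun ℓ s => defectLaw e w ρ (j + 1) j' s) hB ih (defectLaw_eq_zero e w ρ j j') ?_ ?_ F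
    · intro s; simp [defectLaw, defectRatio]; ring
    · intro ℓ a s
      -- Pascal's rule in `j`: the extra leading block is either invisible or accounts for the
      -- letter `a`.
      have h : defectRatio ρ (j + 1) j' (Fin.cons a s : Fin (ℓ + 1) → A)
          = defectRatio ρ j j' (Fin.cons a s : Fin (ℓ + 1) → A) + defectRatio ρ j j' s := by
        simp only [defectRatio, Fin.sum_univ_succ, Fin.cons_zero, Fin.cons_succ, Fin.val_zero,
          Fin.val_succ]
        have e1 : ∀ i : ℕ, ℓ + 1 - 1 - (i + 1) = ℓ - 1 - i := by omega
        have e2 : ((j + 1 + j').choose (ℓ + 1) : ℝ) = (j + j').choose ℓ + (j + j').choose (ℓ + 1) := by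
          rw [show j + 1 + j' = j + j' + 1 by ring]
          exact_mod_cast Nat.choose_succ_succ' _ _
        have e3 : ∀ i : ℕ, ((j + 1).choose (i + 1) : ℝ) = j.choose i + j.choose (i + 1) := fun i => by
          exact_mod_cast Nat.choose_succ_succ' _ _
        simp only [e1, e2, e3, add_mul, Finset.sum_add_distrib, Nat.choose_zero_right]
        ring
      simp only [defectLaw, wordWeight_cons, h]
      ring

end Words

/-! ### From words to traces: the pair of nearly indistinguishable strings. -/

/-- Data processing: merging outcomes cannot decrease the affinity, by Cauchy–Schwarz on each fibre.
-/
theorem sum_sqrt_mul_le_sum_fiber {Ω β : Type*} [Fintype Ω] [DecidableEq β] {P Q : Ω → ℝ}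
    (hP : ∀ ω, 0 ≤ P ω) (hQ : ∀ ω, 0 ≤ Q ω) (φ : Ω → β) (U : Finset β)
    (hU : ∀ u ∉ U, ∑ ω, (if φ ω = u then P ω else 0) = 0) :
    ∑ ω, √(P ω * Q ω) ≤ ∑ u ∈ U, √((∑ ω, if φ ω = u then P ω else 0) *
      (∑ ω, if φ ω = u then Q ω else 0)) := by
  rw [Finset.sum_subset (Finset.subset_union_left (s₂ := Finset.univ.image φ)) fun u _ hu => by
      rw [hU u hu, zero_mul, Real.sqrt_zero],
    ← Finset.sum_fiberwise_of_maps_to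
      (fun ω _ => Finset.mem_union_right U (Finset.mem_image_of_mem φ (Finset.mem_univ ω)))]
  refine Finset.sum_le_sum fun u _ => ?_
  rw [← Finset.sum_filter, ← Finset.sum_filter, Real.sqrt_mul (Finset.sum_nonneg fun ω _ => hP ω)]
  simp_rw [Real.sqrt_mul (hP _)]
  exact Real.sum_sqrt_mul_sqrt_le _ hP hQ

/-- Sets of positions as indicator functions. -/
def indicatorEquiv (n : ℕ) : Finset (Fin n) ≃ (Fin n → Bool) where
  toFun K i := decide (i ∈ K)
  invFun κ := Finset.univ.filter fun i => κ i = true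
  left_inv K := by ext; simp
  right_inv κ := by ext; simp

/-- The trace, as a function of the indicator function of the set of retained positions. -/
def traceOf {n : ℕ} (x κ : Fin n → Bool) : List Bool :=
  ((List.ofFn fun i => (κ i, x i)).filter fun p => p.1).map fun p => p.2

theorem trace_eq_traceOf {n : ℕ} (x : BitString n) (K : Finset (Fin n)) :
    trace x K = traceOf x (indicatorEquiv n K) := by
  rw [trace, traceOf, List.ofFn_eq_map, List.filter_map, List.map_map]
  rfl

/-- The probability of an indicator function of retained positions. -/
def indicatorWeight (q : ℝ) {n : ℕ} (κ : Fin n → Bool) : ℝ := ∏ i, if κ i then 1 - q else q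

theorem retainWeight_eq (q : ℝ) {n : ℕ} (K : Finset (Fin n)) :
    retainWeight q K = indicatorWeight q (indicatorEquiv n K) := by
  simp [retainWeight, indicatorWeight, indicatorEquiv]

theorem traceOf_cons {n : ℕ} (b : Bool) (x : Fin n → Bool) (r : Bool) (κ : Fin n → Bool) :
    traceOf (Fin.cons b x : Fin (n + 1) → Bool) (Fin.cons r κ) =
      if r then b :: traceOf x κ else traceOf x κ := by
  cases r <;> simp [traceOf, List.ofFn_succ]

theorem indicatorWeight_cons (q : ℝ) {n : ℕ} (r : Bool) (κ : Fin n → Bool) :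
    indicatorWeight q (Fin.cons r κ : Fin (n + 1) → Bool)
      = (if r then 1 - q else q) * indicatorWeight q κ := by
  simp [indicatorWeight, Fin.prod_univ_succ]

theorem sum_indicatorWeight_mul (q : ℝ) {n : ℕ} (x : Fin n → Bool) (F : List Bool → ℝ) :
    ∑ κ : Fin n → Bool, indicatorWeight q κ * F (traceOf x κ) = channel q (List.ofFn x) F := by
  induction n generalizing F with
  | zero => simp [indicatorWeight, traceOf, channel]
  | succ n ih =>
    obtain ⟨b, x, rfl⟩ : ∃ b y, x = Fin.cons b y := ⟨x 0, Fin.tail x, (Fin.cons_self_tail x).symm⟩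
    rw [sum_fin_cons, List.ofFn_cons, channel, ← ih, ← ih]
    simp [traceOf_cons, indicatorWeight_cons, mul_assoc, Finset.mul_sum, add_comm]

theorem sum_retainWeight_mul (q : ℝ) {n : ℕ} (x : BitString n) (F : List Bool → ℝ) :
    ∑ K : Finset (Fin n), retainWeight q K * F (trace x K) = channel q (List.ofFn x) F := by
  rw [← sum_indicatorWeight_mul]
  refine Fintype.sum_equiv (indicatorEquiv n) _ _ fun K => ?_
  rw [retainWeight_eq, trace_eq_traceOf]

/-- The law of a single trace. -/
def traceLaw (q : ℝ) {n : ℕ} (x : BitString n) (u : List Bool) : ℝ :=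
  ∑ K : Finset (Fin n), if trace x K = u then retainWeight q K else 0

theorem traceLaw_eq_channel (q : ℝ) {n : ℕ} (x : BitString n) (u : List Bool) :
    traceLaw q x u = channel q (List.ofFn x) fun v => if v = u then 1 else 0 := by
  rw [← sum_retainWeight_mul]
  simp [traceLaw]

theorem retainWeight_nonneg {q : ℝ} (hq : 0 < q) (hq1 : q < 1) {n : ℕ} (K : Finset (Fin n)) :
    0 ≤ retainWeight q K :=
  Finset.prod_nonneg fun i _ => by split_ifs <;> linarith

theorem traceLaw_nonneg {q : ℝ} (hq : 0 < q) (hq1 : q < 1) {n : ℕ} (x : BitString n)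
    (u : List Bool) : 0 ≤ traceLaw q x u :=
  Finset.sum_nonneg fun K _ => by split_ifs <;> [exact retainWeight_nonneg hq hq1 K; rfl]

theorem traceLaw_eq_zero {q : ℝ} {n : ℕ} (x : BitString n)
    (u : List Bool) (h : ∀ K, trace x K ≠ u) : traceLaw q x u = 0 :=
  Finset.sum_eq_zero fun K _ => if_neg (h K)

theorem exists_ofFn_eq {n : ℕ} (l : List Bool) (h : l.length = n) :
    ∃ x : BitString n, List.ofFn x = l := by
  subst h
  exact ⟨l.get, List.ofFn_get l⟩

/-- The letters stand for the traces of a block `01`; a block is invisible with probability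
`q ^ 2 / 2`, and `w` and `w * ρ` are the relative weights of the letters for a block `01` and for a
block `1`. -/
theorem exists_symbol_weights {q : ℝ} (hq : 0 < q) (hq1 : q < 1) :
    ∃ (w ρ : Fin 4 → ℝ) (φ : Fin 4 → List Bool), (∀ a, 0 < w a) ∧ (∀ a, 0 ≤ ρ a) ∧
      ∑ a, w a * ρ a = ∑ a, w a ∧ q ^ 2 / 2 * (1 + ∑ a, w a) = 1 ∧
      (∀ F, channel q [false, true] F = q ^ 2 / 2 * (F [] + ∑ a, w a * F (φ a))) ∧
      (∀ F, channel q [true] F = q ^ 2 / 2 * (F [] + ∑ a, w a * ρ a * F (φ a))) := by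
  have hp : 0 < 1 - q := by linarith
  have hq2 : 0 < 2 - q := by linarith
  -- The empty trace of `01` has probability `q ^ 2`; half of it counts as invisible and half as the
  -- letter `[]`. Keeping this half makes `w` positive at `[]`, so that `ρ` can stay finite although
  -- a block `1` is empty with the larger probability `q`.
  refine ⟨![1, 2 * (1 - q) / q, 2 * (1 - q) / q, 2 * (1 - q) ^ 2 / q ^ 2],
    ![(2 - q) / q, 0, 1 / q, 0], ![[], [false], [true], [false, true]], ?_, ?_, ?_, ?_, ?_, ?_⟩
  · simp only [Fin.forall_fin_succ]
    simp [hq, hp]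
  · simp only [Fin.forall_fin_succ]
    simp
    exact ⟨by positivity, hq.le⟩
  · simp [Fin.sum_univ_four]
    field_simp
    ring
  · simp [Fin.sum_univ_four]
    field_simp
    ring
  · intro F
    simp [channel, Fin.sum_univ_four]
    field_simp
    ring
  · intro F
    simp [channel, Fin.sum_univ_four]
    field_simp
    ring

/-- Two strings whose traces are at squared Hellinger distance of order `k ^ (-3 / 2)`. -/
theorem exists_pair_affinity {q : ℝ} (hq : 0 < q) (hq1 : q < 1) :
    ∃ C : ℝ, 0 < C ∧ ∀ k : ℕ, ∃ x y : BitString (4 * k + 3), x ≠ y ∧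
      ∀ U : Finset (List Bool), (∀ (z : BitString (4 * k + 3)) K, trace z K ∈ U) →
        1 - C / ((k + 1) * √(k + 1)) ≤ ∑ u ∈ U, √(traceLaw q x u * traceLaw q y u) := by
  obtain ⟨w, ρ, φ, hw0, hρ0, h1, h2, hB, hB'⟩ := exists_symbol_weights hq hq1
  have he : 0 < q ^ 2 / 2 := by positivity
  obtain ⟨C, hC, hk⟩ := exists_le_affinity_defectLaw he hw0 hρ0 h1
    (Finset.sum_pos (fun a _ => hw0 a) Finset.univ_nonempty) h2
  refine ⟨C, hC, fun k => ?_⟩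
  obtain ⟨x, hx⟩ := exists_ofFn_eq (n := 4 * k + 3) (defectString k (k + 1))
    (by rw [length_defectString]; ring)
  obtain ⟨y, hy⟩ := exists_ofFn_eq (n := 4 * k + 3) (defectString (k + 1) k)
    (by rw [length_defectString]; ring)
  refine ⟨x, y, ?_, fun U hU => (hk k).trans ?_⟩
  · rintro rfl
    exact defectString_ne k (hx.symm.trans hy)
  have law : ∀ (z : BitString (4 * k + 3)) (j j' : ℕ), List.ofFn z = defectString j j' →
      j + j' + 1 = 2 * (k + 1) → ∀ u, traceLaw q z u = ∑ ω : Words (Fin 4) (2 * (k + 1)),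
        if wordString φ ω.2 = u then defectLaw (q ^ 2 / 2) w ρ j j' ω.2 else 0 := by
    intro z j j' hz hj u
    rw [traceLaw_eq_channel, hz, channel_defectString hB hB', hj, Fintype.sum_sigma,
      Fin.sum_univ_eq_sum_range (fun ℓ => ∑ s : Fin ℓ → Fin 4,
        if wordString φ s = u then defectLaw (q ^ 2 / 2) w ρ j j' s else 0)]
    simp
  have lx := law x k (k + 1) hx (by ring)
  have ly := law y (k + 1) k hy (by ring)
  have hU0 : ∀ u ∉ U, traceLaw q x u = 0 :=
    fun u hu => traceLaw_eq_zero x u fun K hK => hu (hK ▸ hU x K)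
  have main := sum_sqrt_mul_le_sum_fiber
    (P := fun ω : Words (Fin 4) (2 * (k + 1)) => defectLaw (q ^ 2 / 2) w ρ k (k + 1) ω.2)
    (Q := fun ω : Words (Fin 4) (2 * (k + 1)) => defectLaw (q ^ 2 / 2) w ρ (k + 1) k ω.2)
    (fun ω => defectLaw_nonneg he hw0 hρ0 k (k + 1) ω.2)
    (fun ω => defectLaw_nonneg he hw0 hρ0 (k + 1) k ω.2)
    (fun ω => wordString φ ω.2) U (fun u hu => (lx u).symm.trans (hU0 u hu))
  refine main.trans (le_of_eq ?_)
  refine Finset.sum_congr rfl fun u _ => ?_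
  rw [lx, ly]

/-! ### Tuples of traces and dominating measures. -/

/-- Le Cam's inequality: Cauchy–Schwarz applied to `P * Q = min * max`, where the maxima have total
mass at most 2. -/
theorem sq_sum_sqrt_le_sum_min {β : Type*} (S : Finset β) {P Q : β → ℝ} (hP : ∀ b, 0 ≤ P b)
    (hQ : ∀ b, 0 ≤ Q b) (hP1 : ∑ b ∈ S, P b ≤ 1) (hQ1 : ∑ b ∈ S, Q b ≤ 1) :
    (∑ b ∈ S, √(P b * Q b)) ^ 2 / 2 ≤ ∑ b ∈ S, min (P b) (Q b) := by
  have h1 : (∑ b ∈ S, √(P b * Q b)) ^ 2 ≤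
      (∑ b ∈ S, min (P b) (Q b)) * ∑ b ∈ S, max (P b) (Q b) := by
    refine Finset.sum_sq_le_sum_mul_sum_of_sq_le_mul _ (fun b _ => le_min (hP b) (hQ b))
      (fun b _ => (hP b).trans (le_max_left _ _)) fun b _ => ?_
    rw [Real.sq_sqrt (mul_nonneg (hP b) (hQ b)), min_mul_max]
  have h2 : ∑ b ∈ S, max (P b) (Q b) ≤ 2 := by
    calc _ ≤ ∑ b ∈ S, (P b + Q b) := Finset.sum_le_sum fun b _ =>
          max_le (by linarith [hQ b]) (by linarith [hP b])
      _ ≤ 2 := by rw [Finset.sum_add_distrib]; linarith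
  have h3 : 0 ≤ ∑ b ∈ S, min (P b) (Q b) := Finset.sum_nonneg fun b _ => le_min (hP b) (hQ b)
  nlinarith

/-- The law of a tuple of independent traces. -/
def tupleLaw (q : ℝ) {n : ℕ} (x : BitString n) {T : ℕ} (X : Fin T → List Bool) : ℝ :=
  ∏ t, traceLaw q x (X t)

/-- The expectation of a function of a tuple of independent traces. -/
def tupleExp (q : ℝ) {n : ℕ} (x : BitString n) {T : ℕ} (F : (Fin T → List Bool) → ℝ) : ℝ :=
  ∑ K : Fin T → Finset (Fin n), (∏ t, retainWeight q (K t)) * F fun t => trace x (K t)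

/-- The possible traces of strings of length `n`. -/
def traceSet (n : ℕ) : Finset (List Bool) :=
  Finset.univ.image fun p : BitString n × Finset (Fin n) => trace p.1 p.2

theorem trace_mem_traceSet {n : ℕ} (x : BitString n) (K : Finset (Fin n)) :
    trace x K ∈ traceSet n :=
  Finset.mem_image_of_mem (fun p : BitString n × Finset (Fin n) => trace p.1 p.2)
    (Finset.mem_univ (x, K))

/-- The possible tuples of traces of strings of length `n`. -/
def tupleSet (n T : ℕ) : Finset (Fin T → List Bool) := Fintype.piFinset fun _ => traceSet n

theorem tupleLaw_nonneg {q : ℝ} (hq : 0 < q) (hq1 : q < 1) {n : ℕ} (x : BitString n) {T : ℕ}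
    (X : Fin T → List Bool) : 0 ≤ tupleLaw q x X :=
  Finset.prod_nonneg fun _ _ => traceLaw_nonneg hq hq1 x _

theorem tupleExp_eq_sum_tupleLaw (q : ℝ) {n : ℕ} (x : BitString n) {T : ℕ}
    (F : (Fin T → List Bool) → ℝ) :
    tupleExp q x F = ∑ X ∈ tupleSet n T, tupleLaw q x X * F X := by
  have h : ∀ X : Fin T → List Bool, tupleLaw q x X = ∑ K : Fin T → Finset (Fin n),
      if (fun t => trace x (K t)) = X then ∏ t, retainWeight q (K t) else 0 := by
    intro X
    have := Finset.prod_univ_sum (fun _ : Fin T => (Finset.univ : Finset (Finset (Fin n))))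
      fun t K => if trace x K = X t then retainWeight q K else 0
    rw [Fintype.piFinset_univ] at this
    rw [tupleLaw]
    refine this.trans (Finset.sum_congr rfl fun K _ => ?_)
    split_ifs with hK
    · refine Finset.prod_congr rfl fun t _ => if_pos (congrFun hK t)
    · obtain ⟨t, ht⟩ := Function.ne_iff.mp hK
      exact Finset.prod_eq_zero (Finset.mem_univ t) (if_neg ht)
  simp_rw [h, Finset.sum_mul]
  rw [Finset.sum_comm, tupleExp]
  refine Finset.sum_congr rfl fun K _ => ?_
  simp_rw [ite_mul, zero_mul]
  rw [Finset.sum_ite_eq, if_pos]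
  exact Fintype.mem_piFinset.mpr fun t => trace_mem_traceSet x (K t)

theorem sum_retainWeight (q : ℝ) (n : ℕ) : ∑ K : Finset (Fin n), retainWeight q K = 1 := by
  have h := sum_retainWeight_mul q (fun _ : Fin n => true) fun _ => 1
  have h1 : ∀ l : List Bool, channel q l (fun _ => 1) = 1 := by
    intro l
    induction l with
    | nil => rfl
    | cons b l ih => simp [channel, ih]
  simpa [h1] using h

theorem sum_tupleLaw (q : ℝ) {n : ℕ} (x : BitString n) (T : ℕ) :
    ∑ X ∈ tupleSet n T, tupleLaw q x X = 1 := by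
  have h := tupleExp_eq_sum_tupleLaw q x (T := T) fun _ => 1
  simp only [mul_one] at h
  rw [← h, tupleExp]
  simp only [mul_one]
  have := Finset.prod_univ_sum (fun _ : Fin T => (Finset.univ : Finset (Finset (Fin n))))
      fun _ K => retainWeight q K
  rw [Fintype.piFinset_univ] at this
  rw [← this]
  simp [sum_retainWeight]

theorem sum_sqrt_tupleLaw {q : ℝ} (hq : 0 < q) (hq1 : q < 1) {n : ℕ} (x y : BitString n) (T : ℕ) :
    ∑ X ∈ tupleSet n T, √(tupleLaw q x X * tupleLaw q y X)
      = (∑ u ∈ traceSet n, √(traceLaw q x u * traceLaw q y u)) ^ T := by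
  have := Finset.prod_univ_sum (fun _ : Fin T => traceSet n)
      fun _ u => √(traceLaw q x u * traceLaw q y u)
  rw [Finset.prod_const, Finset.card_univ, Fintype.card_fin] at this
  rw [this]
  refine Finset.sum_congr rfl fun X _ => ?_
  rw [tupleLaw, tupleLaw, ← Finset.prod_mul_distrib, Real.sqrt_prod]
  exact fun t _ => mul_nonneg (traceLaw_nonneg hq hq1 x _) (traceLaw_nonneg hq hq1 y _)

/-- The tuples of `T` traces of `n`-bit strings, with any side information that the strings provide,
lead to a correct guess of a uniformly random string with probability at most `V / 2 ^ n`; this is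
witnessed by a measure of mass `V` that dominates all the laws of the tuples. -/
def Dominated (q : ℝ) (T n : ℕ) (V : ℝ) : Prop :=
  ∃ (Ω : Type) (_ : Fintype Ω) (c : Ω → ℝ) (φ : Ω → Fin T → List Bool),
    (∀ ω, 0 ≤ c ω) ∧ ∑ ω, c ω ≤ V ∧
      ∀ F : BitString n → (Fin T → List Bool) → ℝ, (∀ x X, 0 ≤ F x X) →
        ∑ x, tupleExp q x (F x) ≤ ∑ ω, c ω * ∑ x, F x (φ ω)

theorem dominated_of_tupleLaw_le {q : ℝ} (hq : 0 < q) (hq1 : q < 1) {n T : ℕ}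
    (c : (Fin T → List Bool) → ℝ) (hc : ∀ (x : BitString n) X, tupleLaw q x X ≤ c X) :
    Dominated q T n (∑ X ∈ tupleSet n T, c X) := by
  refine ⟨tupleSet n T, inferInstance, fun X => c X, fun X => X,
    fun X => (tupleLaw_nonneg hq hq1 (fun _ => true) X.1).trans (hc _ _), ?_, fun F hF => ?_⟩
  · rw [Finset.sum_coe_sort]
  · rw [Finset.sum_coe_sort (tupleSet n T) fun X => c X * ∑ x, F x X]
    simp_rw [tupleExp_eq_sum_tupleLaw, Finset.mul_sum]
    rw [Finset.sum_comm]
    exact Finset.sum_le_sum fun X _ => Finset.sum_le_sum fun x _ =>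
      mul_le_mul_of_nonneg_right (hc x X) (hF x X)

theorem dominated_two_pow {q : ℝ} (hq : 0 < q) (hq1 : q < 1) (T n : ℕ) :
    Dominated q T n (2 ^ n) := by
  have h := dominated_of_tupleLaw_le hq hq1 (n := n) (T := T) (fun X => ∑ x, tupleLaw q x X)
    fun x X => Finset.single_le_sum (f := fun x => tupleLaw q x X)
      (fun x _ => tupleLaw_nonneg hq hq1 x X) (Finset.mem_univ x)
  rw [Finset.sum_comm] at h
  simpa [sum_tupleLaw] using h

/-- A pair of strings whose traces are hard to distinguish lowers the mass. -/
theorem dominated_of_affinity {q : ℝ} (hq : 0 < q) (hq1 : q < 1) (T : ℕ) {n : ℕ}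
    {x y : BitString n} (hxy : x ≠ y) :
    Dominated q T n
      (2 ^ n - ((∑ u ∈ traceSet n, √(traceLaw q x u * traceLaw q y u)) ^ T) ^ 2 / 2) := by
  have h0 := fun (z : BitString n) (X : Fin T → List Bool) => tupleLaw_nonneg hq hq1 z X
  obtain ⟨Ω, _, c, φ, hc, hV, hF⟩ := dominated_of_tupleLaw_le hq hq1 (n := n) (T := T)
    (fun X => ∑ z : BitString n, tupleLaw q z X - min (tupleLaw q x X) (tupleLaw q y X)) (by
      intro z X
      -- Each law must fit under the sum minus the minimum: some string of the pair differs from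
      -- `z`, and its term pays for the minimum.
      have key : ∀ z' ≠ z, tupleLaw q z X + tupleLaw q z' X ≤ ∑ z : BitString n, tupleLaw q z X := by
        intro z' hz
        rw [← Finset.sum_pair (f := fun z => tupleLaw q z X) hz.symm]
        exact Finset.sum_le_sum_of_subset_of_nonneg (Finset.subset_univ _) fun _ _ _ => h0 _ X
      by_cases hz : x = z
      · have := key y (by rw [← hz]; exact hxy.symm)
        linarith [min_le_right (tupleLaw q x X) (tupleLaw q y X)]
      · linarith [key x hz, min_le_left (tupleLaw q x X) (tupleLaw q y X)])
  refine ⟨Ω, _, c, φ, hc, hV.trans ?_, hF⟩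
  rw [Finset.sum_sub_distrib, Finset.sum_comm]
  have := sq_sum_sqrt_le_sum_min (tupleSet n T) (h0 x) (h0 y) (sum_tupleLaw q x T).le
    (sum_tupleLaw q y T).le
  rw [sum_sqrt_tupleLaw hq hq1] at this
  simp_rw [sum_tupleLaw]
  simp
  linarith

/-! ### Concatenating blocks, and the bound on the success probability. -/

theorem traceOf_append {a b : ℕ} (x κ : Fin a → Bool) (x' κ' : Fin b → Bool) :
    traceOf (Fin.append x x') (Fin.append κ κ') = traceOf x κ ++ traceOf x' κ' := by
  rw [traceOf, traceOf, traceOf, ← List.map_append, ← List.filter_append, ← List.ofFn_fin_append]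
  congr 3
  funext i
  refine Fin.addCases (fun i => ?_) (fun i => ?_) i <;> simp

theorem indicatorWeight_append (q : ℝ) {a b : ℕ} (κ : Fin a → Bool) (κ' : Fin b → Bool) :
    indicatorWeight q (Fin.append κ κ') = indicatorWeight q κ * indicatorWeight q κ' := by
  simp [indicatorWeight, Fin.prod_univ_add]

theorem tupleExp_eq_sum_indicator (q : ℝ) {n : ℕ} (x : BitString n) {T : ℕ}
    (F : (Fin T → List Bool) → ℝ) :
    tupleExp q x F = ∑ κ : Fin T → Fin n → Bool,
      (∏ t, indicatorWeight q (κ t)) * F fun t => traceOf x (κ t) := by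
  refine Fintype.sum_equiv (Equiv.piCongrRight fun _ => indicatorEquiv n) _ _ fun K => ?_
  simp [retainWeight_eq, trace_eq_traceOf]

theorem tupleExp_append (q : ℝ) {a b : ℕ} (x : BitString a) (y : BitString b) {T : ℕ}
    (F : (Fin T → List Bool) → ℝ) :
    tupleExp q (Fin.append x y) F =
      tupleExp q y fun Y => tupleExp q x fun X => F fun t => X t ++ Y t := by
  simp only [tupleExp_eq_sum_indicator]
  rw [← Fintype.sum_equiv ((Equiv.arrowProdEquivProdArrow (Fin T) (fun _ => Fin b → Bool)
    (fun _ => Fin a → Bool)).symm.trans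
    (Equiv.piCongrRight fun _ => (Equiv.prodComm _ _).trans (Fin.appendEquiv a b)))
    (fun p => (∏ t, indicatorWeight q (p.1 t)) * ((∏ t, indicatorWeight q (p.2 t)) *
      F fun t => traceOf x (p.2 t) ++ traceOf y (p.1 t)))]
  · rw [Fintype.sum_prod_type]
    simp_rw [Finset.mul_sum]
  · intro p
    simp [Fin.appendEquiv, traceOf_append, indicatorWeight_append, Finset.prod_mul_distrib]
    ring

/-- The traces of a concatenation are concatenations of independent traces. Dominating the first
part with the second held fixed, and then the second part, yields the product measure; its points
remember where each trace splits. -/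
theorem Dominated.append {q : ℝ} (hq : 0 < q) (hq1 : q < 1) {T a b : ℕ} {V W : ℝ}
    (ha : Dominated q T a V) (hb : Dominated q T b W) : Dominated q T (a + b) (V * W) := by
  obtain ⟨Ω, _, c, φ, hc, hV, hF⟩ := ha
  obtain ⟨Ω', _, c', φ', hc', hW, hF'⟩ := hb
  refine ⟨Ω × Ω', inferInstance, fun p => c p.1 * c' p.2, fun p t => φ p.1 t ++ φ' p.2 t,
    fun p => mul_nonneg (hc _) (hc' _), ?_, fun F hF0 => ?_⟩
  · rw [Fintype.sum_prod_type]
    simp_rw [← Finset.mul_sum, ← Finset.sum_mul]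
    exact mul_le_mul hV hW (Finset.sum_nonneg fun _ _ => hc' _)
      ((Finset.sum_nonneg fun _ _ => hc _).trans hV)
  · have split : ∀ H : BitString (a + b) → ℝ,
        ∑ z, H z = ∑ y : BitString b, ∑ x : BitString a, H (Fin.append x y) := by
      intro H
      rw [Finset.sum_comm, ← Fintype.sum_prod_type' (f := fun x y => H (Fin.append x y))]
      exact (Fintype.sum_equiv (Fin.appendEquiv a b) _ _ fun _ => rfl).symm
    simp_rw [split, tupleExp_append]
    have tupleExp_sum : ∀ (y : BitString b) (H : BitString a → (Fin T → List Bool) → ℝ),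
        ∑ x, tupleExp q y (H x) = tupleExp q y fun Y => ∑ x, H x Y := by
      intro y H
      simp only [tupleExp, Finset.mul_sum]
      exact Finset.sum_comm
    simp_rw [tupleExp_sum]
    have step : ∀ y : BitString b,
        (tupleExp q y fun Y => ∑ x, tupleExp q x fun X => F (Fin.append x y) fun t => X t ++ Y t)
          ≤ tupleExp q y fun Y => ∑ ω, c ω * ∑ x, F (Fin.append x y) fun t => φ ω t ++ Y t := by
      intro y
      refine Finset.sum_le_sum fun K _ => mul_le_mul_of_nonneg_left ?_
        (Finset.prod_nonneg fun t _ => retainWeight_nonneg hq hq1 _)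
      exact hF (fun x X => F (Fin.append x y) fun t => X t ++ trace y (K t)) fun x X => hF0 _ _
    refine (Finset.sum_le_sum fun y _ => step y).trans ?_
    refine (hF' (fun y Y => ∑ ω, c ω * ∑ x, F (Fin.append x y) fun t => φ ω t ++ Y t)
      fun y Y => Finset.sum_nonneg fun ω _ => mul_nonneg (hc ω)
        (Finset.sum_nonneg fun x _ => hF0 _ _)).trans (le_of_eq ?_)
    rw [Fintype.sum_prod_type_right]
    refine Finset.sum_congr rfl fun ω' _ => ?_
    rw [Finset.sum_comm, Finset.mul_sum]
    refine Finset.sum_congr rfl fun ω _ => ?_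
    rw [← Finset.mul_sum]
    ring

theorem Dominated.pow {q : ℝ} (hq : 0 < q) (hq1 : q < 1) {T L : ℕ} {V : ℝ}
    (h : Dominated q T L V) (s : ℕ) : Dominated q T (s * L) (V ^ s) := by
  induction s with
  | zero => simpa using dominated_two_pow hq hq1 T 0
  | succ s ih =>
    rw [Nat.succ_mul, pow_succ]
    exact ih.append hq hq1 h

theorem randomSuccessProb_le_of_dominated {q : ℝ} {T n : ℕ} {V : ℝ}
    (h : Dominated q T n V) (G : (Fin T → List Bool) → BitString n) :
    randomSuccessProb q n T G ≤ V / 2 ^ n := by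
  classical
  obtain ⟨Ω, _, c, φ, hc, hV, hF⟩ := h
  rw [randomSuccessProb, ← Finset.sum_mul, div_eq_mul_inv]
  refine mul_le_mul_of_nonneg_right ?_ (by positivity)
  refine le_trans (le_trans (le_of_eq ?_) (hF (fun x X => if G X = x then 1 else 0)
    fun x X => by split_ifs <;> norm_num)) ?_
  · refine Finset.sum_congr rfl fun x _ => ?_
    rw [traceProb, tupleExp]
    refine Finset.sum_congr rfl fun K _ => ?_
    simp
  · simpa using hV

/-- All `n / L` full blocks gain from the pair; the remaining `n % L` bits use the trivial mass. -/
theorem randomSuccessProb_le {q : ℝ} (hq : 0 < q) (hq1 : q < 1) {T L : ℕ} {x y : BitString L}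
    (hxy : x ≠ y) (n : ℕ) (G : (Fin T → List Bool) → BitString n) :
    randomSuccessProb q n T G ≤
      (1 - ((∑ u ∈ traceSet L, √(traceLaw q x u * traceLaw q y u)) ^ T) ^ 2 / 2 / 2 ^ L) ^ (n / L) := by
  have h := ((dominated_of_affinity hq hq1 T hxy).pow hq hq1 (n / L)).append hq hq1
    (dominated_two_pow hq hq1 T (n % L))
  rw [Nat.div_add_mod'] at h
  refine (randomSuccessProb_le_of_dominated h G).trans (le_of_eq ?_)
  have e : (2 : ℝ) ^ n = (2 ^ L) ^ (n / L) * 2 ^ (n % L) := by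
    rw [← pow_mul, ← pow_add, mul_comm L, Nat.div_add_mod']
  rw [e, mul_div_mul_right _ _ (by positivity), ← div_pow, sub_div, div_self (by positivity)]

/-! ### Choice of the block length and asymptotics. -/

theorem exp_le_one_sub {a : ℝ} (h0 : 0 ≤ a) (h1 : a ≤ 1 / 2) : Real.exp (-(2 * a)) ≤ 1 - a := by
  rw [Real.exp_neg, inv_le_comm₀ (Real.exp_pos _) (by linarith)]
  have h2 : (1 - a)⁻¹ ≤ 2 * a + 1 := by
    rw [inv_le_comm₀ (by linarith) (by linarith), inv_le_iff_one_le_mul₀ (by linarith)]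
    nlinarith
  exact h2.trans (Real.add_one_le_exp _)

theorem nat_div_ge {n L : ℕ} (hL : 0 < L) (h : 2 * L ≤ n) : (n : ℝ) / (2 * L) ≤ ((n / L : ℕ) : ℝ) := by
  have h1 : n < (n / L + 1) * L := by
    have := Nat.div_add_mod' n L
    have := Nat.mod_lt n hL
    nlinarith
  have h2 : (n : ℝ) < (((n / L : ℕ) : ℝ) + 1) * L := by exact_mod_cast h1
  have hL' : (0 : ℝ) < L := by exact_mod_cast hL
  have h3 : 1 ≤ n / L := (Nat.one_le_div_iff hL).mpr (by omega)
  have h4 : (1 : ℝ) ≤ ((n / L : ℕ) : ℝ) := by exact_mod_cast h3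
  rw [div_le_iff₀ (by positivity)]
  nlinarith

/-- The bound on the success probability in terms of `ℓ = log n`. -/
theorem randomSuccessProb_le_exp {q C : ℝ} (hq : 0 < q) (hq1 : q < 1) (hC : 0 < C)
    (hpair : ∀ k : ℕ, ∃ x y : BitString (4 * k + 3), x ≠ y ∧
      ∀ U : Finset (List Bool), (∀ (z : BitString (4 * k + 3)) K, trace z K ∈ U) →
        1 - C / ((k + 1) * √(k + 1)) ≤ ∑ u ∈ U, √(traceLaw q x u * traceLaw q y u))
    {n T : ℕ} {ℓ : ℝ} (hn : (n : ℝ) = Real.exp ℓ) (hℓ : 24 ≤ ℓ)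
    (hCℓ : 2 * C ≤ ℓ / 32 * √(ℓ / 32)) (hT : 16 * C * T ≤ ℓ * (ℓ / 32 * √(ℓ / 32)))
    (hexp : 2 * ℓ * Real.exp (0.15 * ℓ) ≤ Real.exp (ℓ / 2))
    (G : (Fin T → List Bool) → BitString n) :
    randomSuccessProb q n T G ≤ Real.exp (-(n : ℝ) ^ (0.15 : ℝ)) := by
  -- This makes `L = 4 * k + 3 ≤ ℓ / 4` once `24 ≤ ℓ`, so `2 ^ L ≤ n ^ (1/4)`. The affinity costs
  -- another `n ^ (1/4)`, and `δ` stays above `n ^ (-1/2) / 2`.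
  set k := ⌊ℓ / 32⌋₊ with hk
  have hk1 : ℓ / 32 ≤ k + 1 := (Nat.lt_floor_add_one _).le
  have hk2 : (k : ℝ) ≤ ℓ / 32 := Nat.floor_le (by linarith)
  obtain ⟨x, y, hxy, hU⟩ := hpair k
  have haff := hU (traceSet _) trace_mem_traceSet
  set S := ∑ u ∈ traceSet (4 * k + 3), √(traceLaw q x u * traceLaw q y u) with hS
  set Y := ℓ / 32 * √(ℓ / 32) with hY
  have hY0 : 0 < Y := by positivity
  have hYk : Y ≤ (k + 1) * √(k + 1) := by rw [hY]; gcongr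
  have hSY : 1 - C / Y ≤ S := by
    refine le_trans ?_ haff
    gcongr
  have hS1 : Real.exp (-(2 * (C / Y))) ≤ S :=
    (exp_le_one_sub (by positivity) (by rw [div_le_iff₀ hY0]; linarith)).trans hSY
  have hS2 : Real.exp (-(ℓ / 4)) ≤ (S ^ T) ^ 2 := by
    rw [← pow_mul]
    refine le_trans ?_ (pow_le_pow_left₀ (Real.exp_pos _).le hS1 (T * 2))
    rw [← Real.exp_nat_mul, Real.exp_le_exp]
    have : 4 * T * (C / Y) ≤ ℓ / 4 := by
      rw [mul_div_assoc', div_le_iff₀ hY0]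
      linarith
    push_cast
    linarith
  set L := 4 * k + 3 with hL
  have hLr : (L : ℝ) ≤ ℓ / 4 := by rw [hL]; push_cast; linarith
  have h2L : (2 : ℝ) ^ L ≤ Real.exp (ℓ / 4) := by
    calc (2 : ℝ) ^ L ≤ Real.exp 1 ^ L := by
          gcongr
          linarith [Real.add_one_le_exp 1]
      _ = Real.exp L := by rw [← Real.exp_nat_mul, mul_one]
      _ ≤ _ := Real.exp_le_exp.mpr hLr
  have hδ : Real.exp (-(ℓ / 2)) / 2 ≤ (S ^ T) ^ 2 / 2 / 2 ^ L := by
    rw [le_div_iff₀ (by positivity)]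
    calc Real.exp (-(ℓ / 2)) / 2 * 2 ^ L ≤ Real.exp (-(ℓ / 2)) / 2 * Real.exp (ℓ / 4) := by gcongr
      _ = Real.exp (-(ℓ / 4)) / 2 := by
        rw [div_mul_eq_mul_div, ← Real.exp_add]
        congr 2
        ring
      _ ≤ _ := by gcongr
  refine (randomSuccessProb_le hq hq1 hxy n G).trans ?_
  rw [← hS]
  set δ := (S ^ T) ^ 2 / 2 / 2 ^ L with hδ'
  -- A dominating measure has nonnegative mass.
  have hV0 : 0 ≤ 1 - δ := by
    obtain ⟨Ω, _, c, φ, hc, hV, -⟩ := dominated_of_affinity hq hq1 T hxy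
    rw [← hS] at hV
    have := (Finset.sum_nonneg fun ω _ => hc ω).trans hV
    rw [hδ', sub_nonneg, div_le_one (by positivity)]
    linarith
  have hs : Real.exp ℓ / ℓ ≤ ((n / L : ℕ) : ℝ) := by
    have hLpos : 0 < L := by omega
    have hL0 : (0 : ℝ) < L := by exact_mod_cast hLpos
    have h2 : 2 * L ≤ n := by
      have : (2 : ℝ) * L ≤ n := by
        rw [hn]; linarith [Real.add_one_le_exp ℓ]
      exact_mod_cast this
    refine le_trans ?_ (nat_div_ge hLpos h2)
    rw [hn]
    gcongr
    linarith
  have hmain : (n : ℝ) ^ (0.15 : ℝ) ≤ δ * ((n / L : ℕ) : ℝ) := by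
    rw [hn, ← Real.exp_mul, mul_comm ℓ]
    have hℓ0 : 0 < ℓ := by linarith
    calc Real.exp (0.15 * ℓ) ≤ Real.exp (ℓ / 2) / (2 * ℓ) := by
          rw [le_div_iff₀ (by positivity)]; linarith
      _ = Real.exp (-(ℓ / 2)) / 2 * (Real.exp ℓ / ℓ) := by
          rw [div_mul_div_comm, ← Real.exp_add]
          congr 2
          ring
      _ ≤ _ := by gcongr
  calc (1 - δ) ^ (n / L) ≤ Real.exp (-δ) ^ (n / L) := by
        gcongr
        exact Real.one_sub_le_exp_neg δ
    _ = Real.exp (-(δ * ((n / L : ℕ) : ℝ))) := by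
        rw [← Real.exp_nat_mul]
        congr 1
        ring
    _ ≤ _ := by
        rw [Real.exp_le_exp]
        linarith

theorem eventually_le_exp : ∀ᶠ ℓ : ℝ in atTop,
    2 * ℓ * Real.exp (0.15 * ℓ) ≤ Real.exp (ℓ / 2) := by
  have h := Real.tendsto_pow_mul_exp_neg_atTop_nhds_zero 1
  have h2 : Tendsto (fun ℓ : ℝ => 0.35 * ℓ) atTop atTop :=
    tendsto_id.const_mul_atTop (by norm_num)
  filter_upwards [(h.comp h2).eventually (gt_mem_nhds (by norm_num : (0 : ℝ) < 0.1))] with ℓ hℓ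
  simp only [Function.comp, pow_one] at hℓ
  rw [Real.exp_neg, ← div_eq_mul_inv, div_lt_iff₀ (Real.exp_pos _)] at hℓ
  have e : Real.exp (ℓ / 2) = Real.exp (0.35 * ℓ) * Real.exp (0.15 * ℓ) := by
    rw [← Real.exp_add]; congr 1; ring
  rw [e]
  gcongr
  linarith [Real.exp_pos (0.35 * ℓ)]

theorem ceil_rpow_log_div_le {L : ℝ} (hL : Real.exp 1 ≤ L) :
    (⌈1 * L ^ (9 / 4 : ℝ) / √(Real.log L)⌉₊ : ℝ) ≤ 2 * L ^ (9 / 4 : ℝ) := by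
  have hL1 : 1 ≤ L := by linarith [Real.add_one_le_exp 1]
  have h1 : 1 ≤ √(Real.log L) := by
    rw [Real.one_le_sqrt, Real.le_log_iff_exp_le (by linarith)]
    exact hL
  have h2 : 1 ≤ L ^ (9 / 4 : ℝ) := Real.one_le_rpow hL1 (by norm_num)
  have h3 : 1 * L ^ (9 / 4 : ℝ) / √(Real.log L) ≤ L ^ (9 / 4 : ℝ) := by
    rw [one_mul]
    exact div_le_self (by linarith) h1
  have := Nat.ceil_lt_add_one (show 0 ≤ 1 * L ^ (9 / 4 : ℝ) / √(Real.log L) by positivity)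
  linarith

/-- The right side is of order `ℓ ^ (5/2)`; the spare factor `ℓ ^ (1/4)` absorbs every constant. -/
theorem eventually_mul_rpow_le (K : ℝ) : ∀ᶠ ℓ : ℝ in atTop,
    K * ℓ ^ (9 / 4 : ℝ) ≤ ℓ * (ℓ / 32 * √(ℓ / 32)) := by
  filter_upwards [(tendsto_rpow_atTop (by norm_num : (0 : ℝ) < 1 / 4)).eventually_ge_atTop
    (K * (32 * √32)), eventually_gt_atTop 0] with ℓ h1 h0
  have e : ℓ * ℓ * √ℓ = ℓ ^ (1 / 4 : ℝ) * ℓ ^ (9 / 4 : ℝ) := by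
    rw [← Real.rpow_add h0, show (1 / 4 + 9 / 4 : ℝ) = ((2 : ℕ) : ℝ) + 1 / 2 by norm_num,
      Real.rpow_add h0, Real.rpow_natCast, ← Real.sqrt_eq_rpow]
    ring
  rw [Real.sqrt_div h0.le, div_mul_div_comm, mul_div_assoc', le_div_iff₀ (by positivity),
    ← mul_assoc ℓ, e, mul_right_comm]
  gcongr

end TraceReconstruction

theorem proposition4 :
    ∀ q : ℝ, 0 < q → q < 1 →
      ∃ c : ℝ, 0 < c ∧
        ∀ᶠ n : ℕ in atTop,
          ∀ G : (Fin ⌈c * Real.log n ^ (9 / 4 : ℝ) / Real.sqrt (Real.log (Real.log n))⌉₊ →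
              List Bool) → TraceReconstruction.BitString n,
            TraceReconstruction.randomSuccessProb q n
                ⌈c * Real.log n ^ (9 / 4 : ℝ) / Real.sqrt (Real.log (Real.log n))⌉₊ G
              ≤ Real.exp (-(n : ℝ) ^ (0.15 : ℝ)) := by
  intro q hq hq1
  obtain ⟨C, hC, hpair⟩ := TraceReconstruction.exists_pair_affinity hq hq1
  -- Any positive constant would serve, because the argument tolerates order `(log n) ^ (5/2)`
  -- traces.
  refine ⟨1, one_pos, ?_⟩
  have hlog : Tendsto (fun n : ℕ => Real.log n) atTop atTop :=
    Real.tendsto_log_atTop.comp tendsto_natCast_atTop_atTop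
  filter_upwards [eventually_gt_atTop 0, hlog.eventually_ge_atTop 24,
    hlog.eventually_ge_atTop (Real.exp 1),
    hlog.eventually TraceReconstruction.eventually_le_exp,
    hlog.eventually (TraceReconstruction.eventually_mul_rpow_le (32 * C))]
    with n hn h24 h1 hexp hK G
  have hT := TraceReconstruction.ceil_rpow_log_div_le h1
  have hT' : 16 * C * (⌈1 * Real.log n ^ (9 / 4 : ℝ) / √(Real.log (Real.log n))⌉₊ : ℝ)
      ≤ Real.log n * (Real.log n / 32 * √(Real.log n / 32)) := by
    refine le_trans ?_ hK
    nlinarith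
  refine TraceReconstruction.randomSuccessProb_le_exp hq hq1 hC hpair
    (Real.exp_log (by exact_mod_cast hn)).symm h24 ?_ hT' hexp G
  have h2 : Real.log n ≤ Real.log n ^ (9 / 4 : ℝ) :=
    Real.self_le_rpow_of_one_le (by linarith) (by norm_num)
  have h3 : 32 * C * Real.log n ≤ Real.log n * (Real.log n / 32 * √(Real.log n / 32)) :=
    le_trans (by gcongr) hK
  have h4 : 32 * C ≤ Real.log n / 32 * √(Real.log n / 32) :=
    le_of_mul_le_mul_left (by linarith) (show 0 < Real.log n by linarith)
  linarith
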